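/- Let $0<\alpha<1$ and $0<p<1$ be fixed, put $q=1-p$, and let $z_\alpha$ be the upper $\alpha$ quantile of the standard normal distribution, $\Phi(z_\alpha)=1-\alpha$. For $n\ge 1$ let $X\sim\mathrm{Bin}(n,p)$, and let $p_U=p_U(X)$ be the one-sided $1-\alpha$ Clopper--Pearson upper bound: for $X<n$, $p_U$ is the unique number in $[0,1]$ with $$\sum_{k=0}^{X}\binom nk p_U^{k}(1-p_U)^{n-k}=\alpha,$$ and $p_U=1$ for $X=n$. Then, as $n\to\infty$, $$E(p_U-p)=n^{-1/2}z_\alpha(pq)^{1/2}+(3n)^{-1}\Big(2\big(\tfrac12-p\big)z_\alpha^2+1+q\Big)+n^{-3/2}z_\alpha(pq)^{1/2}\Big(-\frac{53}{36}+\frac{\frac12-p}{q}+\frac{z_\alpha^2+\frac{13}{2}}{36pq}-\frac{13z_\alpha^2}{36}\Big)+O(n^{-2}),$$ where the constant in $O(n^{-2})$ may depend on $\alpha$ and $p$. -/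

import Mathlib

open ProbabilityTheory MeasureTheory

/-- The binomial lower tail `P_θ(X ≤ x) = ∑_{k=0}^{x} C(n,k) θ^k (1-θ)^(n-k)`. -/
noncomputable def binomialLowerTail (n x : ℕ) (θ : ℝ) : ℝ :=
  ∑ k ∈ Finset.range (x + 1), (n.choose k : ℝ) * θ ^ k * (1 - θ) ^ (n - k)

open Classical in
/-- The one-sided `1 - α` Clopper–Pearson upper bound computed from the observation `x` out of `n`:
the `θ ∈ [0,1]` with `P_θ(X ≤ x) = α`. For `0 < α < 1` and `x < n` there is exactly one such `θ`
(`existsUnique_binomialLowerTail_eq`). If there is none, as for `x = n`, where the tail is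
identically `1`, the bound is `1`. -/
noncomputable def clopperPearsonUpper (α : ℝ) (n x : ℕ) : ℝ :=
  if h : ∃ θ ∈ Set.Icc (0 : ℝ) 1, binomialLowerTail n x θ = α then h.choose else 1

/-- The upper `α` quantile `z_α` of the standard normal distribution, i.e. its `1 - α` quantile. -/
noncomputable def normalUpperQuantile (α : ℝ) : ℝ :=
  sInf {z : ℝ | 1 - α ≤ cdf (gaussianReal 0 1) z}

theorem hasDerivAt_binomialLowerTail {n x : ℕ} (hx : x < n) (θ : ℝ) :
    HasDerivAt (binomialLowerTail n x)
      (-((n.choose x : ℝ) * ((n - x : ℕ) : ℝ) * θ ^ x * (1 - θ) ^ (n - x - 1))) θ := by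
  have term : ∀ k : ℕ, HasDerivAt (fun t : ℝ => (n.choose k : ℝ) * t ^ k * (1 - t) ^ (n - k))
      ((n.choose k : ℝ) * ((k : ℝ) * θ ^ (k - 1)) * (1 - θ) ^ (n - k) +
        (n.choose k : ℝ) * θ ^ k * (((n - k : ℕ) : ℝ) * (1 - θ) ^ (n - k - 1) * (-1))) θ := by
    intro k
    have h1 : HasDerivAt (fun t : ℝ => 1 - t) (-1) θ := by
      simpa using (hasDerivAt_id θ).const_sub 1
    exact ((hasDerivAt_pow k θ).const_mul _).mul (h1.pow (n - k))
  induction x with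
  | zero =>
    have h := term 0
    have e : binomialLowerTail n 0 =
        fun t : ℝ => (n.choose 0 : ℝ) * t ^ 0 * (1 - t) ^ (n - 0) := by
      funext t; simp [binomialLowerTail]
    rw [e]
    refine h.congr_deriv ?_
    simp
  | succ x ih =>
    have h := (ih (by omega)).add (term (x + 1))
    have e : binomialLowerTail n (x + 1) = binomialLowerTail n x +
        fun t : ℝ => (n.choose (x + 1) : ℝ) * t ^ (x + 1) * (1 - t) ^ (n - (x + 1)) := by
      funext t; simp [binomialLowerTail, Finset.sum_range_succ]
    rw [e]
    refine h.congr_deriv ?_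
    have hc : (n.choose (x + 1) : ℝ) * ((x : ℝ) + 1) = (n.choose x : ℝ) * ((n - x : ℕ) : ℝ) := by
      exact_mod_cast Nat.choose_succ_right_eq n x
    have hs : n - x - 1 = n - (x + 1) := by omega
    rw [hs, ← hc]
    push_cast
    ring

/-- The Clopper–Pearson equation has exactly one solution in `[0,1]` when `x < n`. -/
theorem existsUnique_binomialLowerTail_eq {α : ℝ} (hα0 : 0 < α) (hα1 : α < 1) {n x : ℕ}
    (hx : x < n) : ∃! θ : ℝ, θ ∈ Set.Icc (0 : ℝ) 1 ∧ binomialLowerTail n x θ = α := by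
  have hcont : Continuous (binomialLowerTail n x) :=
    continuous_iff_continuousAt.2 fun θ => (hasDerivAt_binomialLowerTail hx θ).continuousAt
  have hanti : StrictAntiOn (binomialLowerTail n x) (Set.Icc 0 1) := by
    refine strictAntiOn_of_deriv_neg (convex_Icc 0 1) hcont.continuousOn ?_
    intro θ hθ
    rw [interior_Icc] at hθ
    rw [(hasDerivAt_binomialLowerTail hx θ).deriv]
    have h1 : (0 : ℝ) < n.choose x := by exact_mod_cast Nat.choose_pos hx.le
    have h2 : (0 : ℝ) < ((n - x : ℕ) : ℝ) := by exact_mod_cast Nat.sub_pos_of_lt hx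
    have h3 : (0 : ℝ) < θ := hθ.1
    have h4 : (0 : ℝ) < 1 - θ := sub_pos.2 hθ.2
    have : 0 < (n.choose x : ℝ) * ((n - x : ℕ) : ℝ) * θ ^ x * (1 - θ) ^ (n - x - 1) := by
      positivity
    linarith
  have h0 : binomialLowerTail n x 0 = 1 := by
    simp [binomialLowerTail, Finset.sum_range_succ']
  have h1 : binomialLowerTail n x 1 = 0 := by
    unfold binomialLowerTail
    refine Finset.sum_eq_zero fun k hk => ?_
    have hk' : n - k ≠ 0 := by
      have := Finset.mem_range.1 hk
      omega
    simp [hk']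
  obtain ⟨θ, hθ, hθα⟩ := intermediate_value_Icc' (zero_le_one' ℝ) hcont.continuousOn
    (show α ∈ Set.Icc (binomialLowerTail n x 1) (binomialLowerTail n x 0) by
      rw [h0, h1]; exact ⟨hα0.le, hα1.le⟩)
  exact ⟨θ, ⟨hθ, hθα⟩, fun y hy => hanti.injOn hy.1 hθ (hy.2.trans hθα.symm)⟩

theorem clopperPearsonUpper_spec {α : ℝ} (hα0 : 0 < α) (hα1 : α < 1) {n x : ℕ} (hx : x < n) :
    clopperPearsonUpper α n x ∈ Set.Icc (0 : ℝ) 1 ∧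
      binomialLowerTail n x (clopperPearsonUpper α n x) = α := by
  have h : ∃ θ ∈ Set.Icc (0 : ℝ) 1, binomialLowerTail n x θ = α :=
    (existsUnique_binomialLowerTail_eq hα0 hα1 hx).exists
  rw [clopperPearsonUpper, dif_pos h]
  exact h.choose_spec

theorem clopperPearsonUpper_self {α : ℝ} (hα1 : α < 1) (n : ℕ) :
    clopperPearsonUpper α n n = 1 := by
  have h : ¬ ∃ θ ∈ Set.Icc (0 : ℝ) 1, binomialLowerTail n n θ = α := by
    rintro ⟨θ, -, h⟩
    have h1 : binomialLowerTail n n θ = 1 := by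
      have := add_pow θ (1 - θ) n
      simp only [add_sub_cancel, one_pow] at this
      rw [this, binomialLowerTail]
      exact Finset.sum_congr rfl fun k _ => by ring
    linarith
  rw [clopperPearsonUpper, dif_neg h]

/-! In `θ`, the lower tail at `x` is the survival function of the Beta(`x + 1`, `n - x`) law, so
`p_U` is a beta quantile. With `y = x / n`, `s² = y (1 - y)` and `e = n^(-1/2)`, the Cornish–Fisher
polynomial `T(w) = y + e (s w + e A₁(w) + e² A₂(w))` approximates the beta quantile at normal level
`w`. It is verified a posteriori, without Stirling's formula. `A₁` and `A₂` are such that the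
density pulled back along `T`, divided by the Gaussian density, has logarithmic derivative `O(e³)`
with polynomial growth in `w` (`quantileRemainder_spec`, `abs_logDensityRatio_sub_le`). On `|w| ≤
log n` the pulled-back density is therefore `κ φ(w) (1 + O(e³))` up to powers of `1 + |w|`.

The constant `κ` is fixed by total mass: the beta density is unimodal, so the mass beyond `T(± log
n)` is at most the density there, which is `O(κ e³)`. Hence the tail at `T(w)` is `1 - Φ(w) + O(e³)`
(`abs_binomialLowerTail_sub_le`). As `T` has slope `O(e)`, inverting this at `z_α` gives `p_U =
T(z_α) + O(e⁴)`, uniformly for `y` in compact subsets of `(0, 1)`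
(`exists_abs_clopperPearsonUpper_sub_le`).

Finally `T(z_α) - p` is expanded in `d = y - p` to a quadratic polynomial with error `O(e⁴ + e² d² +
d⁴)`. For `d` away from `0` boundedness suffices, since `d⁴` is then bounded below. The binomial
mean of the error is `O(n⁻²)` by the second and fourth central moments, and the mean of the
quadratic needs only the mean and the variance. -/

/-! ### The approximate beta quantile -/

/-- The coefficient of `n⁻¹` in the expansion of the beta quantile at the normal quantile `w`. -/
noncomputable def quantileCoeffTwo (y w : ℝ) : ℝ := ((1 - 2 * y) * w ^ 2 + 2 - y) / 3

/-- The coefficient of `n^(-3/2)` in the expansion of the beta quantile at the normal quantile `w`;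
here `s ^ 2 = y * (1 - y)`. -/
noncomputable def quantileCoeffThree (y s w : ℝ) : ℝ :=
  s⁻¹ * w * ((1 - 13 * y + 13 * y ^ 2) * w ^ 2 + (11 - 35 * y + 17 * y ^ 2)) / 36

/-- The rescaled deviation of the approximate beta quantile from `y`, where `e = n^(-1/2)`. -/
noncomputable def quantileDev (y s e w : ℝ) : ℝ :=
  s * w + e * quantileCoeffTwo y w + e ^ 2 * quantileCoeffThree y s w

/-- The derivative of `quantileDev` in `w`. -/
noncomputable def quantileDevDeriv (y s e w : ℝ) : ℝ :=
  s + e * (2 * (1 - 2 * y) * w / 3) +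
    e ^ 2 * (s⁻¹ * (3 * (1 - 13 * y + 13 * y ^ 2) * w ^ 2 + (11 - 35 * y + 17 * y ^ 2)) / 36)

/-- The second derivative of `quantileDev` in `w`, divided by `e`. -/
noncomputable def quantileDevSecond (y s e w : ℝ) : ℝ :=
  2 * (1 - 2 * y) / 3 + e * (s⁻¹ * (1 - 13 * y + 13 * y ^ 2) * w / 6)

/-- The approximate beta quantile. -/
noncomputable def betaQuantileApprox (y s e w : ℝ) : ℝ := y + e * quantileDev y s e w

theorem hasDerivAt_quantileDev (y s e w : ℝ) :
    HasDerivAt (quantileDev y s e) (quantileDevDeriv y s e w) w := by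
  have h1 := hasDerivAt_id w
  have h2 := hasDerivAt_pow 2 w
  have h3 := hasDerivAt_pow 3 w
  have := ((h1.const_mul s).add
    ((((h2.const_mul (1 - 2 * y)).add_const (2 - y)).div_const 3).const_mul e)).add ((((h3.const_mul (1 - 13 * y + 13 * y ^ 2)).add
      (h1.const_mul (11 - 35 * y + 17 * y ^ 2))).const_mul (s⁻¹ / 36)).const_mul (e ^ 2))
  refine (this.congr_deriv ?_).congr_of_eventuallyEq (.of_forall fun v => ?_)
  · simp only [quantileDevDeriv]; push_cast; ring
  · simp only [quantileDev, quantileCoeffTwo, quantileCoeffThree, Pi.add_apply, id]; ring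

theorem hasDerivAt_quantileDevDeriv (y s e w : ℝ) :
    HasDerivAt (quantileDevDeriv y s e) (e * quantileDevSecond y s e w) w := by
  have h1 := hasDerivAt_id w
  have h2 := hasDerivAt_pow 2 w
  have := ((h1.const_mul (e * (2 * (1 - 2 * y) / 3))).const_add s).add
    ((((h2.const_mul (3 * (1 - 13 * y + 13 * y ^ 2))).add_const
      (11 - 35 * y + 17 * y ^ 2)).const_mul (s⁻¹ / 36)).const_mul (e ^ 2))
  refine (this.congr_deriv ?_).congr_of_eventuallyEq (.of_forall fun v => ?_)
  · simp only [quantileDevSecond]; push_cast; ring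
  · simp only [quantileDevDeriv, Pi.add_apply, id]; ring

theorem hasDerivAt_betaQuantileApprox (y s e w : ℝ) :
    HasDerivAt (betaQuantileApprox y s e) (e * quantileDevDeriv y s e w) w :=
  ((hasDerivAt_quantileDev y s e w).const_mul e).const_add y

/-- The numerator of the logarithmic derivative of the transformed beta density relative to the
Gaussian density is `e ^ 3` times a polynomial. -/
noncomputable def quantileRemainder (y s e w : ℝ) : ℝ :=
  let A := quantileDev y s e w
  let A1 := quantileCoeffTwo y w
  let A2 := quantileCoeffThree y s w
  let Q := A1 + e * A2
  let a1 := 2 * (1 - 2 * y) * w / 3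
  let a2 := s⁻¹ * (3 * (1 - 13 * y + 13 * y ^ 2) * w ^ 2 + (11 - 35 * y + 17 * y ^ 2)) / 36
  let q := a1 + e * a2
  let B := quantileDevSecond y s e w
  let B1 := s⁻¹ * (1 - 13 * y + 13 * y ^ 2) * w / 6
  (B + w * q) * ((1 - 2 * y) * Q - A ^ 2) + 2 * s * q * A + q ^ 2 * (y - Q) + e * q ^ 2 * A
    + ((B1 + w * a2) * ((1 - 2 * y) * (s * w))
      + w * s * ((1 - 2 * y) * A2 - 2 * s * w * Q - e * Q ^ 2) + s ^ 2 * Q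
      + 2 * s * (a2 * (y - A1) - a1 * A2 - e * a2 * A2) - s * w * (2 * a1 * a2 + e * a2 ^ 2))

/-- With `A` the deviation and `T` the approximate quantile, the left side is the logarithmic
derivative of the density ratio cleared of its denominator `A' T (1 - T)`. The coefficients of `e⁰`,
`e¹`, `e²` vanish: the first because `s² = y (1 - y)`, the other two by the choice of `A₁` and `A₂`.
-/
theorem quantileRemainder_spec {y s : ℝ} (hs : s ^ 2 = y * (1 - y)) (hs0 : s ≠ 0) (e w : ℝ) :
    (e * quantileDevSecond y s e w + w * quantileDevDeriv y s e w) *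
        (betaQuantileApprox y s e w * (1 - betaQuantileApprox y s e w)) +
      quantileDevDeriv y s e w ^ 2 *
        (-quantileDev y s e w + e * y + e ^ 2 * quantileDev y s e w) =
      e ^ 3 * quantileRemainder y s e w := by
  have hr : s * s⁻¹ = 1 := mul_inv_cancel₀ hs0
  simp only [quantileRemainder, betaQuantileApprox, quantileDevSecond, quantileDevDeriv,
    quantileDev, quantileCoeffTwo, quantileCoeffThree]
  generalize s⁻¹ = r at *
  have hy : y * (1 - y) = s ^ 2 := hs.symm
  set A1 := ((1 - 2 * y) * w ^ 2 + 2 - y) / 3 with hA1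
  set A2 := r * w * ((1 - 13 * y + 13 * y ^ 2) * w ^ 2 + (11 - 35 * y + 17 * y ^ 2)) / 36 with hA2
  set a1 := 2 * (1 - 2 * y) * w / 3 with ha1
  set a2 := r * (3 * (1 - 13 * y + 13 * y ^ 2) * w ^ 2 + (11 - 35 * y + 17 * y ^ 2)) / 36 with ha2
  set B1 := r * (1 - 13 * y + 13 * y ^ 2) * w / 6 with hB1
  set B0 := 2 * (1 - 2 * y) / 3 with hB0
  -- Order `e`: with `a1 = A₁'` and `B0 = A₁''`, this is the equation `A₁ + w A₁' - A₁'' = (1 - 2y)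
  -- w² + y`.
  have e1 : -A1 + B0 - a1 * w + w ^ 2 - 2 * w ^ 2 * y + y = 0 := by
    rw [hA1, hB0, ha1]; ring
  -- Order `e²`: an equation of the same type for `A₂`, with `a2 = A₂'`, `B1 = A₂''` and a source
  -- term built from `A₁`.
  have e2 : -2 * A1 * a1 * s + A1 * s * w - 2 * A1 * s * w * y - A2 * s ^ 2 + B0 * s * w
      - 2 * B0 * s * w * y + B1 * s ^ 2 + a1 * s * w ^ 2 - 2 * a1 * s * w ^ 2 * y + 2 * a1 * s * y
      - a1 ^ 2 * s * w - a2 * s ^ 2 * w + s ^ 3 * w - s ^ 3 * w ^ 3 = 0 := by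
    have x1 : A2 * s ^ 2 = s * (w * ((1 - 13 * y + 13 * y ^ 2) * w ^ 2
        + (11 - 35 * y + 17 * y ^ 2)) / 36) := by
      rw [hA2]; linear_combination (s * (w * ((1 - 13 * y + 13 * y ^ 2) * w ^ 2
        + (11 - 35 * y + 17 * y ^ 2)) / 36)) * hr
    have x2 : a2 * s ^ 2 = s * ((3 * (1 - 13 * y + 13 * y ^ 2) * w ^ 2
        + (11 - 35 * y + 17 * y ^ 2)) / 36) := by
      rw [ha2]; linear_combination (s * ((3 * (1 - 13 * y + 13 * y ^ 2) * w ^ 2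
        + (11 - 35 * y + 17 * y ^ 2)) / 36)) * hr
    have x3 : B1 * s ^ 2 = s * ((1 - 13 * y + 13 * y ^ 2) * w / 6) := by
      rw [hB1]; linear_combination (s * ((1 - 13 * y + 13 * y ^ 2) * w / 6)) * hr
    rw [x1, x2, x3, show s ^ 3 = s * (y * (1 - y)) by rw [hy]; ring, hA1, hB0, ha1]
    ring
  clear_value A1 A2 a1 a2 B1 B0
  linear_combination (e * s ^ 2) * e1 + e ^ 2 * e2 +
    (e * (B0 + e * B1) + w * (s + e * a1 + e ^ 2 * a2)) * hy

/-! ### Polynomial bounds, uniform in the parameters -/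

/-- `f` grows at most polynomially in its last argument `w`, uniformly over `y ∈ [0,1]`,
`s ∈ [η,1]` and `e ∈ [0,1]`. -/
def PolyBounded (η : ℝ) (f : ℝ → ℝ → ℝ → ℝ → ℝ) : Prop :=
  ∃ (C : ℝ) (k : ℕ), 0 ≤ C ∧ ∀ y s e w : ℝ, 0 ≤ y → y ≤ 1 → η ≤ s → s ≤ 1 → 0 ≤ e → e ≤ 1 →
    |f y s e w| ≤ C * (1 + |w|) ^ k

namespace PolyBounded

variable {η : ℝ} {f g : ℝ → ℝ → ℝ → ℝ → ℝ}

theorem const (c : ℝ) : PolyBounded η fun _ _ _ _ => c :=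
  ⟨|c|, 0, abs_nonneg c, fun _ _ _ _ _ _ _ _ _ _ => by simp⟩

theorem add (hf : PolyBounded η f) (hg : PolyBounded η g) :
    PolyBounded η fun y s e w => f y s e w + g y s e w := by
  obtain ⟨C, k, hC, h⟩ := hf
  obtain ⟨D, l, hD, h'⟩ := hg
  refine ⟨C + D, k + l, by positivity, fun y s e w h1 h2 h3 h4 h5 h6 => ?_⟩
  have t : 1 ≤ 1 + |w| := by linarith [abs_nonneg w]
  calc |f y s e w + g y s e w| ≤ |f y s e w| + |g y s e w| := abs_add_le _ _
    _ ≤ C * (1 + |w|) ^ k + D * (1 + |w|) ^ l :=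
        add_le_add (h _ _ _ _ h1 h2 h3 h4 h5 h6) (h' _ _ _ _ h1 h2 h3 h4 h5 h6)
    _ ≤ C * (1 + |w|) ^ (k + l) + D * (1 + |w|) ^ (k + l) := by
        gcongr <;> first | exact t | omega
    _ = _ := by ring

theorem mul (hf : PolyBounded η f) (hg : PolyBounded η g) :
    PolyBounded η fun y s e w => f y s e w * g y s e w := by
  obtain ⟨C, k, hC, h⟩ := hf
  obtain ⟨D, l, hD, h'⟩ := hg
  refine ⟨C * D, k + l, by positivity, fun y s e w h1 h2 h3 h4 h5 h6 => ?_⟩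
  calc |f y s e w * g y s e w| = |f y s e w| * |g y s e w| := abs_mul _ _
    _ ≤ (C * (1 + |w|) ^ k) * (D * (1 + |w|) ^ l) :=
        mul_le_mul (h _ _ _ _ h1 h2 h3 h4 h5 h6) (h' _ _ _ _ h1 h2 h3 h4 h5 h6)
          (abs_nonneg _) (by positivity)
    _ = _ := by ring

theorem sub (hf : PolyBounded η f) (hg : PolyBounded η g) :
    PolyBounded η fun y s e w => f y s e w - g y s e w := by
  simpa [sub_eq_add_neg] using hf.add ((const (-1)).mul hg)

theorem pow (hf : PolyBounded η f) (n : ℕ) : PolyBounded η fun y s e w => f y s e w ^ n := by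
  induction n with
  | zero => simpa using const 1
  | succ n ih => simpa [pow_succ] using ih.mul hf

theorem div_const (hf : PolyBounded η f) (c : ℝ) : PolyBounded η fun y s e w => f y s e w / c := by
  simpa [div_eq_mul_inv] using hf.mul (const c⁻¹)

theorem fst : PolyBounded η fun y _ _ _ => y :=
  ⟨1, 0, zero_le_one, fun y s e w h1 h2 _ _ _ _ => by simpa [abs_of_nonneg h1] using h2⟩

theorem snd (hη : 0 < η) : PolyBounded η fun _ s _ _ => s :=
  ⟨1, 0, zero_le_one, fun y s e w _ _ h1 h2 _ _ => by
    simpa [abs_of_nonneg (hη.le.trans h1)] using h2⟩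

theorem snd_inv (hη : 0 < η) : PolyBounded η fun _ s _ _ => s⁻¹ :=
  ⟨η⁻¹, 0, by positivity, fun y s e w _ _ h1 h2 _ _ => by
    have : 0 < s := hη.trans_le h1
    rw [abs_of_pos (by positivity), pow_zero, mul_one]
    exact inv_anti₀ hη h1⟩

theorem thd : PolyBounded η fun _ _ e _ => e :=
  ⟨1, 0, zero_le_one, fun y s e w _ _ _ _ h1 h2 => by simpa [abs_of_nonneg h1] using h2⟩

theorem last : PolyBounded η fun _ _ _ w => w :=
  ⟨1, 1, zero_le_one, fun y s e w _ _ _ _ _ _ => by simp⟩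

theorem quantileCoeffTwo : PolyBounded η fun y _ _ w => quantileCoeffTwo y w :=
  (((((const 1).sub ((const 2).mul fst)).mul (last.pow 2)).add (const 2)).sub fst).div_const 3

theorem cubicCoeff : PolyBounded η fun y _ _ _ => 1 - 13 * y + 13 * y ^ 2 :=
  ((const 1).sub ((const 13).mul fst)).add ((const 13).mul (fst.pow 2))

theorem linearCoeff : PolyBounded η fun y _ _ _ => 11 - 35 * y + 17 * y ^ 2 :=
  ((const 11).sub ((const 35).mul fst)).add ((const 17).mul (fst.pow 2))

theorem quantileCoeffThree (hη : 0 < η) :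
    PolyBounded η fun y s _ w => quantileCoeffThree y s w :=
  (((snd_inv hη).mul last).mul ((cubicCoeff.mul (last.pow 2)).add linearCoeff)).div_const 36

theorem quantileDev (hη : 0 < η) : PolyBounded η quantileDev :=
  (((snd hη).mul last).add (thd.mul quantileCoeffTwo)).add
    ((thd.pow 2).mul (quantileCoeffThree hη))

theorem slopeCoeff : PolyBounded η fun y _ _ w => 2 * (1 - 2 * y) * w / 3 :=
  (((const 2).mul ((const 1).sub ((const 2).mul fst))).mul last).div_const 3

theorem slopeCoeffThree (hη : 0 < η) : PolyBounded η fun y s _ w =>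
    s⁻¹ * (3 * (1 - 13 * y + 13 * y ^ 2) * w ^ 2 + (11 - 35 * y + 17 * y ^ 2)) / 36 :=
  ((snd_inv hη).mul ((((const 3).mul cubicCoeff).mul (last.pow 2)).add linearCoeff)).div_const 36

theorem curvatureCoeff (hη : 0 < η) : PolyBounded η fun y s _ w =>
    s⁻¹ * (1 - 13 * y + 13 * y ^ 2) * w / 6 :=
  (((snd_inv hη).mul cubicCoeff).mul last).div_const 6

theorem quantileDevSecond (hη : 0 < η) : PolyBounded η quantileDevSecond :=
  (((const 2).mul ((const 1).sub ((const 2).mul fst))).div_const 3).add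
    (thd.mul (curvatureCoeff hη))

theorem quantileRemainder (hη : 0 < η) : PolyBounded η quantileRemainder := by
  have A := quantileDev hη
  have A1 : PolyBounded η _ := quantileCoeffTwo
  have A2 := quantileCoeffThree hη
  have Q := A1.add (thd.mul A2)
  have a1 : PolyBounded η _ := slopeCoeff
  have a2 := slopeCoeffThree hη
  have q := a1.add (thd.mul a2)
  have B := quantileDevSecond hη
  have B1 := curvatureCoeff hη
  have l : PolyBounded η fun y _ _ _ => 1 - 2 * y := (const 1).sub ((const 2).mul fst)
  have s := snd hη
  have two : PolyBounded η fun _ _ _ _ => 2 := const 2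
  exact ((((((B.add (last.mul q)).mul ((l.mul Q).sub (A.pow 2))).add
    (((two.mul s).mul q).mul A)).add ((q.pow 2).mul (fst.sub Q))).add
    ((thd.mul (q.pow 2)).mul A))).add
    (((((((B1.add (last.mul a2)).mul (l.mul (s.mul last))).add
      ((last.mul s).mul (((l.mul A2).sub (((two.mul s).mul last).mul Q)).sub
        (thd.mul (Q.pow 2))))).add ((s.pow 2).mul Q)).add
      ((two.mul s).mul (((a2.mul (fst.sub A1)).sub (a1.mul A2)).sub ((thd.mul a2).mul A2)))).sub
      ((s.mul last).mul (((two.mul a1).mul a2).add (thd.mul (a2.pow 2))))))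

end PolyBounded

/-- One constant and one exponent serve all three estimates. The factor `e` in the second keeps the
slope positive wherever `e` times the polynomial is small. -/
theorem exists_quantile_bounds {η : ℝ} (hη : 0 < η) :
    ∃ (C : ℝ) (k : ℕ), 1 ≤ C ∧ ∀ y s e w : ℝ, 0 ≤ y → y ≤ 1 → η ≤ s → s ≤ 1 → 0 ≤ e → e ≤ 1 →
      |quantileDev y s e w| ≤ C * (1 + |w|) ^ k ∧
      |quantileDevDeriv y s e w - s| ≤ e * (C * (1 + |w|) ^ k) ∧
      |quantileRemainder y s e w| ≤ C * (1 + |w|) ^ k := by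
  obtain ⟨C1, k1, hC1, h1⟩ := PolyBounded.quantileDev hη
  obtain ⟨C2, k2, hC2, h2⟩ :=
    PolyBounded.slopeCoeff.add (PolyBounded.thd.mul (PolyBounded.slopeCoeffThree hη))
  obtain ⟨C3, k3, hC3, h3⟩ := PolyBounded.quantileRemainder hη
  refine ⟨1 + C1 + C2 + C3, k1 + k2 + k3, by linarith, fun y s e w a b c d i j => ?_⟩
  have t : 1 ≤ 1 + |w| := by linarith [abs_nonneg w]
  have key : ∀ (D : ℝ) (l : ℕ), 0 ≤ D → D ≤ 1 + C1 + C2 + C3 → l ≤ k1 + k2 + k3 →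
      D * (1 + |w|) ^ l ≤ (1 + C1 + C2 + C3) * (1 + |w|) ^ (k1 + k2 + k3) := by
    intro D l _ hD hl
    gcongr
  refine ⟨(h1 y s e w a b c d i j).trans (key _ _ hC1 (by linarith) (by omega)), ?_,
    (h3 y s e w a b c d i j).trans (key _ _ hC3 (by linarith) (by omega))⟩
  have := (h2 y s e w a b c d i j).trans (key _ _ hC2 (by linarith) (by omega))
  calc |quantileDevDeriv y s e w - s| = |e * (2 * (1 - 2 * y) * w / 3 +
        e * (s⁻¹ * (3 * (1 - 13 * y + 13 * y ^ 2) * w ^ 2 + (11 - 35 * y + 17 * y ^ 2)) /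
          36))| := by
        congr 1; rw [quantileDevDeriv]; ring
    _ ≤ _ := by rw [abs_mul, abs_of_nonneg i]; gcongr

/-! ### The standard normal distribution -/

theorem gaussianPDFReal_std (w : ℝ) :
    gaussianPDFReal 0 1 w = (√(2 * Real.pi))⁻¹ * Real.exp (-(w ^ 2 / 2)) := by
  simp [gaussianPDFReal_def, neg_div]

theorem gaussianPDFReal_std_le (w : ℝ) : gaussianPDFReal 0 1 w ≤ Real.exp (-(w ^ 2 / 2)) := by
  rw [gaussianPDFReal_std]
  refine mul_le_of_le_one_left (Real.exp_pos _).le (inv_le_one_of_one_le₀ ?_)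
  rw [Real.one_le_sqrt]
  nlinarith [Real.pi_gt_three]

theorem continuous_gaussianPDFReal_std : Continuous (gaussianPDFReal 0 1) := by
  simp_rw [funext gaussianPDFReal_std]
  fun_prop

theorem cdf_gaussianReal_std_sub (a b : ℝ) :
    cdf (gaussianReal 0 1) b - cdf (gaussianReal 0 1) a = ∫ t in a..b, gaussianPDFReal 0 1 t := by
  have h : ∀ c, cdf (gaussianReal 0 1) c = ∫ t in Set.Iic c, gaussianPDFReal 0 1 t := fun c => by
    rw [cdf_eq_real, measureReal_def, gaussianReal_apply_eq_integral 0 one_ne_zero,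
      ENNReal.toReal_ofReal (integral_nonneg fun t => gaussianPDFReal_nonneg 0 1 t)]
  rw [h, h]
  exact intervalIntegral.integral_Iic_sub_Iic (integrable_gaussianPDFReal 0 1).integrableOn
    (integrable_gaussianPDFReal 0 1).integrableOn

theorem hasDerivAt_cdf_gaussianReal_std (w : ℝ) :
    HasDerivAt (cdf (gaussianReal 0 1)) (gaussianPDFReal 0 1 w) w := by
  have h := intervalIntegral.integral_hasDerivAt_right (a := 0) (b := w)
    (continuous_gaussianPDFReal_std.intervalIntegrable _ _)
    (continuous_gaussianPDFReal_std.stronglyMeasurableAtFilter _ _)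
    continuous_gaussianPDFReal_std.continuousAt
  refine (h.const_add (cdf (gaussianReal 0 1) 0)).congr_of_eventuallyEq (.of_forall fun v => ?_)
  simp only
  rw [← cdf_gaussianReal_std_sub]
  ring

theorem strictMono_cdf_gaussianReal_std : StrictMono (cdf (gaussianReal 0 1)) := by
  refine strictMono_of_deriv_pos fun w => ?_
  rw [(hasDerivAt_cdf_gaussianReal_std w).deriv]
  exact gaussianPDFReal_pos 0 1 w one_ne_zero

theorem cdf_normalUpperQuantile {α : ℝ} (hα0 : 0 < α) (hα1 : α < 1) :
    cdf (gaussianReal 0 1) (normalUpperQuantile α) = 1 - α := by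
  have hc : Continuous (cdf (gaussianReal 0 1)) :=
    continuous_iff_continuousAt.2 fun w => (hasDerivAt_cdf_gaussianReal_std w).continuousAt
  obtain ⟨z, hz⟩ : ∃ z, cdf (gaussianReal 0 1) z = 1 - α :=
    mem_range_of_exists_le_of_exists_ge hc
      (((tendsto_cdf_atBot _).eventually (ge_mem_nhds (by linarith))).exists)
      (((tendsto_cdf_atTop _).eventually (le_mem_nhds (by linarith))).exists)
  have hset : {w : ℝ | 1 - α ≤ cdf (gaussianReal 0 1) w} = Set.Ici z := by
    ext w
    simp [← hz, strictMono_cdf_gaussianReal_std.le_iff_le]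
  rw [normalUpperQuantile, hset, csInf_Ici, hz]

/-- Chernoff bound with exponent `4`. At `W = log n` it gives `O(n⁻⁴)`, more than enough. -/
theorem cdf_gaussianReal_std_neg_le (W : ℝ) :
    cdf (gaussianReal 0 1) (-W) ≤ Real.exp 8 * Real.exp (-(4 * W)) := by
  have h := measure_le_le_exp_mul_mgf (μ := gaussianReal 0 1) (X := id) (-W) (t := -4) (by norm_num)
    (integrable_exp_mul_gaussianReal (-4))
  rw [mgf_id_gaussianReal] at h
  rw [cdf_eq_real]
  refine h.trans (le_of_eq ?_)
  rw [mul_comm]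
  norm_num

theorem one_sub_cdf_gaussianReal_std_le (W : ℝ) :
    1 - cdf (gaussianReal 0 1) W ≤ Real.exp 8 * Real.exp (-(4 * W)) := by
  have h := measure_ge_le_exp_mul_mgf (μ := gaussianReal 0 1) (X := id) W (t := 4) (by norm_num)
    (integrable_exp_mul_gaussianReal 4)
  rw [mgf_id_gaussianReal] at h
  rw [cdf_eq_real, ← probReal_compl_eq_one_sub measurableSet_Iic]
  refine (measureReal_mono ?_).trans (h.trans (le_of_eq ?_))
  · intro w hw
    simp only [Set.mem_compl_iff, Set.mem_Iic, not_le] at hw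
    exact hw.le
  · rw [mul_comm]
    norm_num

/-- The majorant `1 / (1 + w²)` is chosen for its explicit bounded primitive, the arctangent. -/
theorem pow_mul_gaussianPDFReal_std_le (k : ℕ) (w : ℝ) :
    (1 + |w|) ^ k * gaussianPDFReal 0 1 w ≤
      ((k + 2).factorial * Real.exp 2) * (1 / (1 + w ^ 2)) := by
  have hpos : 0 < 1 + w ^ 2 := by positivity
  have h1 : (1 + |w|) ^ (k + 2) ≤ (k + 2).factorial * Real.exp (1 + |w|) := by
    have := Real.pow_div_factorial_le_exp (1 + |w|) (by positivity) (k + 2)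
    rwa [div_le_iff₀ (by positivity), mul_comm] at this
  have h2 : 1 + w ^ 2 ≤ (1 + |w|) ^ 2 := by
    nlinarith [abs_nonneg w, sq_abs w]
  rw [mul_one_div, le_div_iff₀ hpos]
  calc (1 + |w|) ^ k * gaussianPDFReal 0 1 w * (1 + w ^ 2)
      ≤ (1 + |w|) ^ k * Real.exp (-(w ^ 2 / 2)) * (1 + |w|) ^ 2 := by
        gcongr
        exact gaussianPDFReal_std_le w
    _ = (1 + |w|) ^ (k + 2) * Real.exp (-(w ^ 2 / 2)) := by ring
    _ ≤ ((k + 2).factorial * Real.exp (1 + |w|)) * Real.exp (-(w ^ 2 / 2)) := by gcongr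
    _ = (k + 2).factorial * Real.exp (1 + |w| - w ^ 2 / 2) := by
        rw [mul_assoc, ← Real.exp_add]; ring_nf
    _ ≤ _ := by
        gcongr
        nlinarith [sq_abs w, sq_nonneg (|w| - 1)]

/-- A function whose derivative is relatively close to `-κ` times the Gaussian density has
increments close to those of `-κ` times the Gaussian distribution function. -/
theorem abs_sub_sub_cdf_gaussianReal_std_le {F E : ℝ → ℝ} {κ D a b : ℝ} {k : ℕ} (hab : a ≤ b)
    (hκ : 0 ≤ κ) (hD : 0 ≤ D)
    (hF : ∀ w ∈ Set.Icc a b, HasDerivAt F (-(κ * gaussianPDFReal 0 1 w * E w)) w)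
    (hE : ∀ w ∈ Set.Icc a b, |E w - 1| ≤ D * (1 + |w|) ^ k) :
    |F a - F b - κ * (cdf (gaussianReal 0 1) b - cdf (gaussianReal 0 1) a)| ≤
      κ * (D * ((k + 2).factorial * Real.exp 2) * Real.pi) := by
  set M : ℝ := (k + 2).factorial * Real.exp 2 with hM
  have hM0 : 0 < M := by positivity
  have hbd : ∀ w ∈ Set.Icc a b, |κ * gaussianPDFReal 0 1 w - κ * gaussianPDFReal 0 1 w * E w| ≤
      κ * D * M * (1 / (1 + w ^ 2)) := by
    intro w hw
    have hφ := gaussianPDFReal_nonneg 0 1 w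
    calc |κ * gaussianPDFReal 0 1 w - κ * gaussianPDFReal 0 1 w * E w|
        = κ * gaussianPDFReal 0 1 w * |E w - 1| := by
          rw [show κ * gaussianPDFReal 0 1 w - κ * gaussianPDFReal 0 1 w * E w =
            -(κ * gaussianPDFReal 0 1 w * (E w - 1)) by ring, abs_neg, abs_mul,
            abs_of_nonneg (mul_nonneg hκ hφ)]
      _ ≤ κ * gaussianPDFReal 0 1 w * (D * (1 + |w|) ^ k) := by gcongr; exact hE w hw
      _ = κ * D * ((1 + |w|) ^ k * gaussianPDFReal 0 1 w) := by ring
      _ ≤ κ * D * (M * (1 / (1 + w ^ 2))) :=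
          mul_le_mul_of_nonneg_left (pow_mul_gaussianPDFReal_std_le k w) (by positivity)
      _ = _ := by ring
  have hder : ∀ c : ℝ, ∀ w ∈ Set.Icc a b, HasDerivAt
      (fun v => F v + κ * cdf (gaussianReal 0 1) v + c * Real.arctan v)
      (-(κ * gaussianPDFReal 0 1 w * E w) + κ * gaussianPDFReal 0 1 w + c * (1 / (1 + w ^ 2))) w :=
    fun c w hw => ((hF w hw).add ((hasDerivAt_cdf_gaussianReal_std w).const_mul κ)).add
      ((Real.hasDerivAt_arctan w).const_mul c)
  -- Adding or subtracting a multiple of `arctan` absorbs the error in the derivative. The increment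
  -- of `arctan` is at most `π`, which replaces an integral estimate over `[a, b]`.
  have hmono : MonotoneOn
      (fun v => F v + κ * cdf (gaussianReal 0 1) v + (κ * D * M) * Real.arctan v)
      (Set.Icc a b) := by
    refine monotoneOn_of_deriv_nonneg (convex_Icc a b)
      (fun w hw => (hder _ w hw).continuousAt.continuousWithinAt)
      (fun w hw => (hder _ w (interior_subset hw)).differentiableAt.differentiableWithinAt)
      fun w hw => ?_
    rw [(hder _ w (interior_subset hw)).deriv]
    linarith [(abs_le.1 (hbd w (interior_subset hw))).1]
  have hanti : AntitoneOn
      (fun v => F v + κ * cdf (gaussianReal 0 1) v + (-(κ * D * M)) * Real.arctan v)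
      (Set.Icc a b) := by
    refine antitoneOn_of_deriv_nonpos (convex_Icc a b)
      (fun w hw => (hder _ w hw).continuousAt.continuousWithinAt)
      (fun w hw => (hder _ w (interior_subset hw)).differentiableAt.differentiableWithinAt)
      fun w hw => ?_
    rw [(hder _ w (interior_subset hw)).deriv]
    linarith [(abs_le.1 (hbd w (interior_subset hw))).2]
  have h1 := hmono (Set.left_mem_Icc.2 hab) (Set.right_mem_Icc.2 hab) hab
  have h2 := hanti (Set.left_mem_Icc.2 hab) (Set.right_mem_Icc.2 hab) hab
  simp only at h1 h2
  have h3 : Real.arctan b - Real.arctan a ≤ Real.pi := by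
    linarith [Real.arctan_lt_pi_div_two b, Real.neg_pi_div_two_lt_arctan a]
  have h4 : κ * D * M * (Real.arctan b - Real.arctan a) ≤ κ * D * M * Real.pi := by gcongr
  rw [abs_le]
  constructor <;> nlinarith

theorem tendsto_log_pow_mul_inv_sqrt (C : ℝ) (k : ℕ) :
    Filter.Tendsto (fun n : ℕ => (√(n : ℝ))⁻¹ * (C * (1 + Real.log n) ^ k)) Filter.atTop
      (nhds 0) := by
  have h := (isLittleO_log_rpow_rpow_atTop (k : ℝ)
    (show (0 : ℝ) < 1 / 2 by norm_num)).tendsto_div_nhds_zero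
  -- Substituting `exp 1 * n` turns `log` into `1 + log n`.
  have hu : Filter.Tendsto (fun n : ℕ => Real.exp 1 * (n : ℝ)) Filter.atTop Filter.atTop :=
    tendsto_natCast_atTop_atTop.const_mul_atTop (Real.exp_pos 1)
  have h2 := (h.comp hu).const_mul (C * √(Real.exp 1))
  rw [mul_zero] at h2
  refine h2.congr' ?_
  filter_upwards [Filter.eventually_gt_atTop 0] with n hn
  have hn' : (0 : ℝ) < n := by exact_mod_cast hn
  have he := Real.exp_pos 1
  have hs : 0 < √(n : ℝ) := Real.sqrt_pos.2 hn'
  have hs' : 0 < √(Real.exp 1) := Real.sqrt_pos.2 he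
  simp only [Function.comp]
  rw [Real.log_mul he.ne' hn'.ne', Real.log_exp, Real.rpow_natCast, ← Real.sqrt_eq_rpow,
    Real.sqrt_mul he.le]
  field_simp

/-! ### The beta density is unimodal -/

/-- The hypothesis puts `θ` on the side of `t` away from the mode `x / (x + m)`. The bound `u ≤ exp
(u - 1)`, applied to `θ / t` and `(1 - θ) / (1 - t)`, bounds the ratio of the two sides by the
exponential of `(θ - t) (x - (x + m) t) / (t (1 - t))`. -/
theorem pow_mul_pow_le_of_unimodal {x m : ℕ} {t θ : ℝ} (ht0 : 0 < t) (ht1 : t < 1) (hθ0 : 0 ≤ θ)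
    (hθ1 : θ ≤ 1) (h : (θ - t) * (x - (x + m) * t) ≤ 0) :
    θ ^ x * (1 - θ) ^ m ≤ t ^ x * (1 - t) ^ m := by
  have ht1' : 0 < 1 - t := sub_pos.2 ht1
  have h1 : (θ / t) ^ x ≤ Real.exp (x * (θ / t - 1)) := by
    rw [Real.exp_nat_mul]
    exact pow_le_pow_left₀ (by positivity) (by linarith [Real.add_one_le_exp (θ / t - 1)]) x
  have h2 : ((1 - θ) / (1 - t)) ^ m ≤ Real.exp (m * ((1 - θ) / (1 - t) - 1)) := by
    rw [Real.exp_nat_mul]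
    exact pow_le_pow_left₀ (div_nonneg (by linarith) ht1'.le)
      (by linarith [Real.add_one_le_exp ((1 - θ) / (1 - t) - 1)]) m
  have h3 : (x : ℝ) * (θ / t - 1) + m * ((1 - θ) / (1 - t) - 1) ≤ 0 := by
    have : (x : ℝ) * (θ / t - 1) + m * ((1 - θ) / (1 - t) - 1) =
        ((θ - t) * (x - (x + m) * t)) / (t * (1 - t)) := by
      field_simp
      ring
    rw [this]
    exact div_nonpos_of_nonpos_of_nonneg h (by positivity)
  have h4 : (θ / t) ^ x * ((1 - θ) / (1 - t)) ^ m ≤ 1 := by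
    calc _ ≤ Real.exp (x * (θ / t - 1)) * Real.exp (m * ((1 - θ) / (1 - t) - 1)) := by
          exact mul_le_mul h1 h2 (pow_nonneg (div_nonneg (by linarith) ht1'.le) _)
            (Real.exp_pos _).le
      _ = Real.exp (x * (θ / t - 1) + m * ((1 - θ) / (1 - t) - 1)) := (Real.exp_add _ _).symm
      _ ≤ 1 := Real.exp_le_one_iff.2 h3
  have h5 : (θ / t) ^ x * ((1 - θ) / (1 - t)) ^ m =
      (θ ^ x * (1 - θ) ^ m) / (t ^ x * (1 - t) ^ m) := by
    rw [div_pow, div_pow, div_mul_div_comm]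
  rw [h5, div_le_one (by positivity)] at h4
  exact h4

/-- The density of the beta distribution with parameters `x + 1` and `n - x`. -/
noncomputable def binomialTailDensity (n x : ℕ) (θ : ℝ) : ℝ :=
  (n.choose x : ℝ) * ((n - x : ℕ) : ℝ) * θ ^ x * (1 - θ) ^ (n - x - 1)

theorem binomialTailDensity_le_of_unimodal {n x : ℕ} (hx : x < n) {t θ : ℝ} (ht0 : 0 < t)
    (ht1 : t < 1) (hθ0 : 0 ≤ θ) (hθ1 : θ ≤ 1) (h : (θ - t) * (x - (n - 1) * t) ≤ 0) :
    binomialTailDensity n x θ ≤ binomialTailDensity n x t := by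
  have e : (x : ℝ) + (n - x - 1 : ℕ) = n - 1 := by
    rw [Nat.sub_sub, Nat.cast_sub hx]; push_cast; ring
  have := pow_mul_pow_le_of_unimodal (x := x) (m := n - x - 1) ht0 ht1 hθ0 hθ1 (by rwa [e])
  unfold binomialTailDensity
  rw [mul_assoc, mul_assoc _ (t ^ x)]
  gcongr

theorem binomialLowerTail_zero (n x : ℕ) : binomialLowerTail n x 0 = 1 := by
  simp [binomialLowerTail, Finset.sum_range_succ']

theorem binomialLowerTail_one {n x : ℕ} (hx : x < n) : binomialLowerTail n x 1 = 0 := by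
  refine Finset.sum_eq_zero fun k hk => ?_
  have hk' : n - k ≠ 0 := by
    have := Finset.mem_range.1 hk
    omega
  simp [hk']

/-- By the mean value theorem the mass on `[t, 1]` is `1 - t ≤ 1` times the density at some point
beyond `t`. To the right of the mode `x / (n - 1)` that density is at most its value at `t`. -/
theorem binomialLowerTail_le_density {n x : ℕ} (hx : x < n) {t : ℝ} (ht0 : 0 < t) (ht1 : t < 1)
    (h : x ≤ (n - 1) * t) : binomialLowerTail n x t ≤ binomialTailDensity n x t := by
  have hd : 0 ≤ binomialTailDensity n x t := by
    have : 0 ≤ 1 - t := by linarith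
    unfold binomialTailDensity; positivity
  obtain ⟨c, hc, hc'⟩ := exists_hasDerivAt_eq_slope (binomialLowerTail n x) _ ht1
    (fun θ _ => (hasDerivAt_binomialLowerTail hx θ).continuousAt.continuousWithinAt)
    fun θ _ => hasDerivAt_binomialLowerTail hx θ
  rw [binomialLowerTail_one hx, eq_div_iff (by linarith)] at hc'
  have := binomialTailDensity_le_of_unimodal hx ht0 ht1 (ht0.trans hc.1).le hc.2.le
    (mul_nonpos_of_nonneg_of_nonpos (by linarith [hc.1]) (by linarith))
  unfold binomialTailDensity at this hd ⊢
  nlinarith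

theorem one_sub_binomialLowerTail_le_density {n x : ℕ} (hx : x < n) {t : ℝ} (ht0 : 0 < t)
    (ht1 : t < 1) (h : (n - 1) * t ≤ x) :
    1 - binomialLowerTail n x t ≤ binomialTailDensity n x t := by
  have hd : 0 ≤ binomialTailDensity n x t := by
    have : 0 ≤ 1 - t := by linarith
    unfold binomialTailDensity; positivity
  obtain ⟨c, hc, hc'⟩ := exists_hasDerivAt_eq_slope (binomialLowerTail n x) _ ht0
    (fun θ _ => (hasDerivAt_binomialLowerTail hx θ).continuousAt.continuousWithinAt)
    fun θ _ => hasDerivAt_binomialLowerTail hx θ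
  rw [binomialLowerTail_zero, eq_div_iff (by linarith)] at hc'
  have := binomialTailDensity_le_of_unimodal hx ht0 ht1 hc.1.le (hc.2.trans ht1).le
    (mul_nonpos_of_nonpos_of_nonneg (by linarith [hc.2]) (by linarith))
  unfold binomialTailDensity at this hd ⊢
  nlinarith

theorem strictAntiOn_binomialLowerTail {n x : ℕ} (hx : x < n) :
    StrictAntiOn (binomialLowerTail n x) (Set.Icc 0 1) := by
  refine strictAntiOn_of_deriv_neg (convex_Icc 0 1)
    (fun θ _ => (hasDerivAt_binomialLowerTail hx θ).continuousAt.continuousWithinAt) fun θ hθ => ?_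
  rw [interior_Icc] at hθ
  rw [(hasDerivAt_binomialLowerTail hx θ).deriv]
  have h1 : (0 : ℝ) < n.choose x := by exact_mod_cast Nat.choose_pos hx.le
  have h2 : (0 : ℝ) < ((n - x : ℕ) : ℝ) := by exact_mod_cast Nat.sub_pos_of_lt hx
  have h3 : (0 : ℝ) < θ := hθ.1
  have h4 : (0 : ℝ) < 1 - θ := sub_pos.2 hθ.2
  have : 0 < (n.choose x : ℝ) * ((n - x : ℕ) : ℝ) * θ ^ x * (1 - θ) ^ (n - x - 1) := by
    positivity
  linarith

/-! ### Comparison of the transformed beta density with the Gaussian density -/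

/-- The logarithm of the ratio of the beta density, transported by `betaQuantileApprox`, to the
Gaussian density, up to an additive constant. -/
noncomputable def logDensityRatio (X M y s e w : ℝ) : ℝ :=
  X * Real.log (betaQuantileApprox y s e w) + M * Real.log (1 - betaQuantileApprox y s e w) +
    Real.log (quantileDevDeriv y s e w) + w ^ 2 / 2

theorem hasDerivAt_logDensityRatio {X M N y s e w : ℝ} (hs : s ^ 2 = y * (1 - y)) (hs0 : s ≠ 0)
    (hN : N * e ^ 2 = 1) (hX : X = N * y) (hM : M = N - X - 1)
    (hT0 : 0 < betaQuantileApprox y s e w) (hT1 : betaQuantileApprox y s e w < 1)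
    (hA : 0 < quantileDevDeriv y s e w) :
    HasDerivAt (logDensityRatio X M y s e) (e ^ 3 * quantileRemainder y s e w /
      (quantileDevDeriv y s e w *
        (betaQuantileApprox y s e w * (1 - betaQuantileApprox y s e w)))) w := by
  have hT := hasDerivAt_betaQuantileApprox y s e w
  have h1 := (hT.log hT0.ne').const_mul X
  have h2 := ((hT.const_sub 1).log (sub_pos.2 hT1).ne').const_mul M
  have h3 := (hasDerivAt_quantileDevDeriv y s e w).log hA.ne'
  have h4 := (hasDerivAt_pow 2 w).div_const 2
  refine (((h1.add h2).add h3).add h4).congr_deriv ?_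
  rw [← quantileRemainder_spec hs hs0 e w]
  have hTe : betaQuantileApprox y s e w = y + e * quantileDev y s e w := rfl
  -- As `X + M = N - 1` and `X = N y`, the bracket is `N y - (N - 1) T`. Multiplying by `e` and
  -- using `N e² = 1` removes `N`.
  have key : e * (X * (1 - betaQuantileApprox y s e w) - M * betaQuantileApprox y s e w) =
      -quantileDev y s e w + e * y + e ^ 2 * quantileDev y s e w := by
    rw [hM, hX, hTe]
    linear_combination -quantileDev y s e w * hN
  rw [← key]
  have hT1' : 1 - betaQuantileApprox y s e w ≠ 0 := (sub_pos.2 hT1).ne'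
  have hT0' := hT0.ne'
  have hA' := hA.ne'
  generalize betaQuantileApprox y s e w = T at *
  generalize quantileDevDeriv y s e w = A at *
  field_simp
  push_cast
  ring

theorem exp_logDensityRatio {x m : ℕ} {y s e w : ℝ} (hT0 : 0 < betaQuantileApprox y s e w)
    (hT1 : betaQuantileApprox y s e w < 1) (hA : 0 < quantileDevDeriv y s e w) :
    Real.exp (logDensityRatio x m y s e w) = betaQuantileApprox y s e w ^ x *
      (1 - betaQuantileApprox y s e w) ^ m * quantileDevDeriv y s e w * Real.exp (w ^ 2 / 2) := by
  rw [logDensityRatio, Real.exp_add, Real.exp_add, Real.exp_add, Real.exp_nat_mul,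
    Real.exp_nat_mul, Real.exp_log hT0, Real.exp_log (sub_pos.2 hT1), Real.exp_log hA]

theorem quantile_bounds_of_small {η y s e δ w : ℝ} (hη : 0 < η) (hy0 : η ≤ y) (hy1 : y ≤ 1 - η)
    (hsη : η ≤ s) (he : 0 ≤ e) (hδ : e * δ ≤ η / 4)
    (h1 : |quantileDev y s e w| ≤ δ) (h2 : |quantileDevDeriv y s e w - s| ≤ e * δ) :
    η / 2 ≤ betaQuantileApprox y s e w ∧ betaQuantileApprox y s e w ≤ 1 - η / 2 ∧
      η / 2 ≤ quantileDevDeriv y s e w := by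
  have h3 : |e * quantileDev y s e w| ≤ e * δ := by
    rw [abs_mul, abs_of_nonneg he]; gcongr
  unfold betaQuantileApprox
  have := abs_le.1 h3
  have := abs_le.1 h2
  refine ⟨?_, ?_, ?_⟩ <;> linarith

theorem abs_logDensityRatio_sub_le {X M N y s e η C W : ℝ} {k : ℕ} (hη : 0 < η) (hy0 : η ≤ y)
    (hy1 : y ≤ 1 - η) (hs : s ^ 2 = y * (1 - y)) (hsη : η ≤ s) (he : 0 ≤ e)
    (hN : N * e ^ 2 = 1) (hX : X = N * y) (hM : M = N - X - 1) (hC : 0 ≤ C)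
    (hb : ∀ w, |quantileDev y s e w| ≤ C * (1 + |w|) ^ k ∧
      |quantileDevDeriv y s e w - s| ≤ e * (C * (1 + |w|) ^ k) ∧
      |quantileRemainder y s e w| ≤ C * (1 + |w|) ^ k)
    (hW : e * (C * (1 + W) ^ k) ≤ η / 4) {w : ℝ} (hw : |w| ≤ W) :
    |logDensityRatio X M y s e w - logDensityRatio X M y s e 0| ≤
      8 * C / η ^ 3 * e ^ 3 * (1 + |w|) ^ (k + 1) := by
  have hmono : ∀ v, |v| ≤ |w| → C * (1 + |v|) ^ k ≤ C * (1 + |w|) ^ k := fun v hv => by gcongr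
  have hwW : e * (C * (1 + |w|) ^ k) ≤ η / 4 := le_trans (by gcongr) hW
  have hgood : ∀ v, |v| ≤ |w| → η / 2 ≤ betaQuantileApprox y s e v ∧
      betaQuantileApprox y s e v ≤ 1 - η / 2 ∧ η / 2 ≤ quantileDevDeriv y s e v := fun v hv =>
    quantile_bounds_of_small hη hy0 hy1 hsη he hwW ((hb v).1.trans (hmono v hv))
      ((hb v).2.1.trans (mul_le_mul_of_nonneg_left (hmono v hv) he))
  have hder : ∀ v ∈ Set.Icc (-|w|) |w|, HasDerivWithinAt (logDensityRatio X M y s e)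
      (e ^ 3 * quantileRemainder y s e v / (quantileDevDeriv y s e v *
        (betaQuantileApprox y s e v * (1 - betaQuantileApprox y s e v)))) (Set.Icc (-|w|) |w|) v :=
    fun v hv => by
      obtain ⟨g1, g2, g3⟩ := hgood v (abs_le.2 hv)
      exact (hasDerivAt_logDensityRatio hs (hη.trans_le hsη).ne' hN hX hM (by linarith)
        (by linarith) (by linarith)).hasDerivWithinAt
  have hbound : ∀ v ∈ Set.Icc (-|w|) |w|, ‖e ^ 3 * quantileRemainder y s e v /
      (quantileDevDeriv y s e v *
        (betaQuantileApprox y s e v * (1 - betaQuantileApprox y s e v)))‖ ≤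
      8 * C / η ^ 3 * e ^ 3 * (1 + |w|) ^ k := fun v hv => by
    obtain ⟨g1, g2, g3⟩ := hgood v (abs_le.2 hv)
    -- The three factors `A'`, `T`, `1 - T` are each at least `η / 2`, whence `8 / η³`. The extra
    -- power of `1 + |w|` in the conclusion comes from integrating over a length `|w|`.
    have hden : η / 2 * (η / 2 * (η / 2)) ≤ quantileDevDeriv y s e v *
        (betaQuantileApprox y s e v * (1 - betaQuantileApprox y s e v)) := by
      have g4 : η / 2 ≤ 1 - betaQuantileApprox y s e v := by linarith
      have g5 : 0 ≤ betaQuantileApprox y s e v := by linarith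
      have g6 : 0 ≤ quantileDevDeriv y s e v := by linarith
      gcongr
    have hden0 : 0 < η / 2 * (η / 2 * (η / 2)) := by positivity
    rw [Real.norm_eq_abs, abs_div, abs_of_pos (hden0.trans_le hden), abs_mul,
      abs_of_nonneg (by positivity : 0 ≤ e ^ 3)]
    calc e ^ 3 * |quantileRemainder y s e v| / _
        ≤ e ^ 3 * (C * (1 + |w|) ^ k) / (η / 2 * (η / 2 * (η / 2))) := by
          gcongr
          exact (hb v).2.2.trans (hmono v (abs_le.2 hv))
      _ = _ := by field_simp; ring
  have := (convex_Icc (-|w|) |w|).norm_image_sub_le_of_norm_hasDerivWithin_le hder hbound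
    (x := 0) (y := w) ⟨by simp, by simp⟩ (abs_le.1 le_rfl)
  rw [sub_zero, Real.norm_eq_abs, Real.norm_eq_abs] at this
  refine this.trans ?_
  rw [pow_succ (1 + |w|), ← mul_assoc]
  gcongr
  linarith

/-! ### Normalization by total mass and the estimate of the lower tail -/

theorem quantileDev_zero_bounds {y s e : ℝ} (hy0 : 0 ≤ y) (hy1 : y ≤ 1) (he : 0 ≤ e) :
    0 ≤ quantileDev y s e 0 ∧ quantileDev y s e 0 ≤ e := by
  simp only [quantileDev, quantileCoeffTwo, quantileCoeffThree]
  constructor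
  · have : 0 ≤ e * (2 - y) := mul_nonneg he (by linarith)
    simp; nlinarith
  · have : 0 ≤ e * (1 + y) := mul_nonneg he (by linarith)
    simp; nlinarith

theorem mul_sub_le_quantileDev_sub {y s e c a b : ℝ} (hab : a ≤ b)
    (h : ∀ v ∈ Set.Icc a b, c ≤ quantileDevDeriv y s e v) :
    c * (b - a) ≤ quantileDev y s e b - quantileDev y s e a :=
  (convex_Icc a b).mul_sub_le_image_sub_of_le_deriv
    (fun v _ => (hasDerivAt_quantileDev y s e v).continuousAt.continuousWithinAt)
    (fun v _ => (hasDerivAt_quantileDev y s e v).differentiableAt.differentiableWithinAt)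
    (fun v hv => by
      rw [(hasDerivAt_quantileDev y s e v).deriv]; exact h v (interior_subset hv))
    a (Set.left_mem_Icc.2 hab) b (Set.right_mem_Icc.2 hab) hab

theorem hasDerivAt_binomialLowerTail_betaQuantileApprox {n x : ℕ} (hx : x < n) {y s e w : ℝ}
    (hT0 : 0 < betaQuantileApprox y s e w)
    (hT1 : betaQuantileApprox y s e w < 1) (hA : 0 < quantileDevDeriv y s e w) :
    HasDerivAt (fun v => binomialLowerTail n x (betaQuantileApprox y s e v))
      (-((n.choose x * (n - x : ℕ) * e * √(2 * Real.pi) *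
          Real.exp (logDensityRatio x (n - x - 1 : ℕ) y s e 0)) * gaussianPDFReal 0 1 w *
        Real.exp (logDensityRatio x (n - x - 1 : ℕ) y s e w -
          logDensityRatio x (n - x - 1 : ℕ) y s e 0))) w := by
  refine ((hasDerivAt_binomialLowerTail hx _).comp w
    (hasDerivAt_betaQuantileApprox y s e w)).congr_deriv ?_
  rw [Real.exp_sub, exp_logDensityRatio hT0 hT1 hA, gaussianPDFReal_std, Real.exp_neg]
  have h1 : √(2 * Real.pi) ≠ 0 := (Real.sqrt_pos.2 (by positivity)).ne'
  have h2 := (Real.exp_pos (logDensityRatio x (n - x - 1 : ℕ) y s e 0)).ne'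
  have h3 := (Real.exp_pos (w ^ 2 / 2)).ne'
  field_simp

theorem binomialTailDensity_betaQuantileApprox {n x : ℕ} {y s e w : ℝ} (he : e ≠ 0)
    (hT0 : 0 < betaQuantileApprox y s e w)
    (hT1 : betaQuantileApprox y s e w < 1) (hA : 0 < quantileDevDeriv y s e w) :
    binomialTailDensity n x (betaQuantileApprox y s e w) =
      (n.choose x * (n - x : ℕ) * e * √(2 * Real.pi) *
          Real.exp (logDensityRatio x (n - x - 1 : ℕ) y s e 0)) * gaussianPDFReal 0 1 w *
        Real.exp (logDensityRatio x (n - x - 1 : ℕ) y s e w -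
          logDensityRatio x (n - x - 1 : ℕ) y s e 0) / (e * quantileDevDeriv y s e w) := by
  rw [Real.exp_sub, exp_logDensityRatio hT0 hT1 hA, gaussianPDFReal_std, Real.exp_neg,
    binomialTailDensity]
  have h1 : √(2 * Real.pi) ≠ 0 := (Real.sqrt_pos.2 (by positivity)).ne'
  have h2 := (Real.exp_pos (logDensityRatio x (n - x - 1 : ℕ) y s e 0)).ne'
  have h3 := (Real.exp_pos (w ^ 2 / 2)).ne'
  have h4 := hA.ne'
  field_simp

/-- The arithmetic that eliminates the unknown `κ`. Indices `0` and `1` stand for the endpoints `-W`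
and `W`. All errors on the beta side are relative to `κ`, so the total mass `1` yields `|1 - κ| ≤ κ
(u + 2v + 2g) ≤ κ / 2`. Hence `κ ≤ 2`, and the relative errors become absolute ones. -/
theorem abs_sub_le_of_normalization {κ f₀ f₁ f φ₀ φ₁ φ u v g : ℝ} (hκ : 0 ≤ κ)
    (h₀ : |f₀ - f₁ - κ * (φ₁ - φ₀)| ≤ κ * u) (h : |f - f₁ - κ * (φ₁ - φ)| ≤ κ * u)
    (hf₁ : 0 ≤ f₁) (hf₁' : f₁ ≤ κ * v) (hf₀ : 1 - f₀ ≤ κ * v) (hf₀' : f₀ ≤ 1)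
    (hφ₁ : 1 - φ₁ ≤ g) (hφ₁' : φ₁ ≤ 1) (hφ₀ : 0 ≤ φ₀) (hφ₀' : φ₀ ≤ g) (hφ : 0 ≤ φ) (hφ' : φ ≤ φ₁)
    (hv : 0 ≤ v) (hsmall : u + 2 * v + 2 * g ≤ 1 / 2) :
    |f - (1 - φ)| ≤ 2 * u + 2 * v + 2 * (u + 2 * v + 2 * g) + g := by
  have h₁ : |1 - κ| ≤ κ * (u + 2 * v + 2 * g) := by
    have h := abs_le.1 h₀
    have h5 : κ * (1 - φ₁ + φ₀) ≤ κ * (2 * g) := by gcongr; linarith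
    have h6 : 0 ≤ κ * (1 - φ₁ + φ₀) := mul_nonneg hκ (by linarith)
    have h8 : 0 ≤ κ * v := by positivity
    rw [abs_le]
    constructor <;> linarith
  have hκ2 : κ ≤ 2 := by
    have h1 := (abs_le.1 h₁).1
    have : κ * (u + 2 * v + 2 * g) ≤ κ * (1 / 2) := by gcongr
    linarith
  have hκu : 0 ≤ κ * u := (abs_nonneg _).trans h
  have hκ0 : 0 < κ := by
    rcases hκ.eq_or_lt with h0 | h0
    · rw [← h0] at h₁; norm_num at h₁
    · exact h0
  have hu0 : 0 ≤ u := nonneg_of_mul_nonneg_right hκu hκ0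
  have hu : κ * u ≤ 2 * u := by gcongr
  have hv' : κ * v ≤ 2 * v := by gcongr
  have hκ3 : |1 - κ| ≤ 2 * (u + 2 * v + 2 * g) :=
    h₁.trans (mul_le_mul_of_nonneg_right hκ2 (by linarith))
  have hprod : |(1 - κ) * (φ₁ - φ)| ≤ 2 * (u + 2 * v + 2 * g) := by
    rw [abs_mul, abs_of_nonneg (by linarith : 0 ≤ φ₁ - φ)]
    exact (mul_le_of_le_one_right (abs_nonneg _) (by linarith)).trans hκ3
  have a1 := abs_le.1 h
  have a2 := abs_le.1 hprod
  rw [abs_le]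
  constructor <;> linarith

theorem abs_binomialLowerTail_sub_le {n x : ℕ} {y s e η C W : ℝ} {k : ℕ} (hη : 0 < η)
    (hy0 : η ≤ y) (hy1 : y ≤ 1 - η) (hs : s ^ 2 = y * (1 - y)) (hsη : η ≤ s)
    (he : 0 < e) (he1 : e ≤ 1) (hn : 2 ≤ n) (hxn : x < n)
    (hN : n * e ^ 2 = 1) (hX : (x : ℝ) = n * y) (hC : 0 ≤ C)
    (hb : ∀ w, |quantileDev y s e w| ≤ C * (1 + |w|) ^ k ∧
      |quantileDevDeriv y s e w - s| ≤ e * (C * (1 + |w|) ^ k) ∧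
      |quantileRemainder y s e w| ≤ C * (1 + |w|) ^ k)
    (hW : e * (C * (1 + W) ^ k) ≤ η / 4)
    (hW1 : 8 * C / η ^ 3 * e ^ 3 * (1 + W) ^ (k + 1) ≤ 1)
    (hW4 : 4 ≤ W) (hWη : 6 / η ≤ W) (hWe : Real.exp (-(2 * W)) ≤ e ^ 4)
    {K₁ K₂ : ℝ} (hK₁ : K₁ = 16 * C / η ^ 3 * ((k + 1 + 2).factorial * Real.exp 2) * Real.pi)
    (hK₂ : K₂ = K₁ + 12 / η + 2 * Real.exp 8) (hK₂e : K₂ * e ^ 3 ≤ 1 / 2)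
    {w : ℝ} (hw : |w| ≤ W) :
    |binomialLowerTail n x (betaQuantileApprox y s e w) - (1 - cdf (gaussianReal 0 1) w)| ≤
      (2 * K₁ + 12 / η + 2 * K₂ + Real.exp 8) * e ^ 3 := by
  set m := n - x - 1 with hm
  have hMr : (m : ℝ) = n - x - 1 := by
    rw [hm, Nat.sub_sub, Nat.cast_sub hxn]; push_cast; ring
  set κ : ℝ := n.choose x * (n - x : ℕ) * e * √(2 * Real.pi) *
    Real.exp (logDensityRatio x m y s e 0) with hκ
  have hκ0 : 0 ≤ κ := by positivity
  set F := fun v => binomialLowerTail n x (betaQuantileApprox y s e v) with hF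
  set Φ := cdf (gaussianReal 0 1) with hΦ
  have hgood : ∀ v, |v| ≤ W → η / 2 ≤ betaQuantileApprox y s e v ∧
      betaQuantileApprox y s e v ≤ 1 - η / 2 ∧ η / 2 ≤ quantileDevDeriv y s e v := fun v hv => by
    have hm : C * (1 + |v|) ^ k ≤ C * (1 + W) ^ k := by gcongr
    exact quantile_bounds_of_small hη hy0 hy1 hsη he.le hW ((hb v).1.trans hm)
      ((hb v).2.1.trans (mul_le_mul_of_nonneg_left hm he.le))
  have hH : ∀ v, |v| ≤ W → |logDensityRatio x m y s e v - logDensityRatio x m y s e 0| ≤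
      8 * C / η ^ 3 * e ^ 3 * (1 + |v|) ^ (k + 1) := fun v hv =>
    abs_logDensityRatio_sub_le hη hy0 hy1 hs hsη he.le hN hX hMr hC hb hW hv
  have hH1 : ∀ v, |v| ≤ W → |logDensityRatio x m y s e v - logDensityRatio x m y s e 0| ≤ 1 :=
    fun v hv => (hH v hv).trans (le_trans (by gcongr) hW1)
  have hE : ∀ v, |v| ≤ W →
      |Real.exp (logDensityRatio x m y s e v - logDensityRatio x m y s e 0) - 1| ≤
        16 * C / η ^ 3 * e ^ 3 * (1 + |v|) ^ (k + 1) := fun v hv =>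
    (Real.abs_exp_sub_one_le (hH1 v hv)).trans
      ((mul_le_mul_of_nonneg_left (hH v hv) zero_le_two).trans_eq (by ring))
  have hcomp : ∀ a b, -W ≤ a → a ≤ b → b ≤ W →
      |F a - F b - κ * (Φ b - Φ a)| ≤ κ * (K₁ * e ^ 3) := by
    intro a b ha hab hbW
    have hin : ∀ v ∈ Set.Icc a b, |v| ≤ W := fun v hv =>
      abs_le.2 ⟨ha.trans hv.1, hv.2.trans hbW⟩
    refine (abs_sub_sub_cdf_gaussianReal_std_le (κ := κ) (D := 16 * C / η ^ 3 * e ^ 3) hab hκ0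
      (by positivity) (fun v hv => ?_) fun v hv => hE v (hin v hv)).trans_eq ?_
    · obtain ⟨g1, g2, g3⟩ := hgood v (hin v hv)
      exact hasDerivAt_binomialLowerTail_betaQuantileApprox hxn (by linarith) (by linarith)
        (by linarith)
    · rw [hK₁]; ring
  -- At `|v| = W` the Gaussian density is at most `exp (-2W) ≤ e⁴`, because `W ≥ 4`. One power of
  -- `e` is lost to the Jacobian `e A'`, whose second factor is at least `η / 2`.
  have hdens : ∀ v, |v| = W → binomialTailDensity n x (betaQuantileApprox y s e v) ≤
      κ * (6 / η * e ^ 3) := by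
    intro v hv
    obtain ⟨g1, g2, g3⟩ := hgood v hv.le
    rw [binomialTailDensity_betaQuantileApprox he.ne' (by linarith) (by linarith) (by linarith)]
    have hφ : gaussianPDFReal 0 1 v ≤ e ^ 4 := by
      refine (gaussianPDFReal_std_le v).trans (le_trans (Real.exp_le_exp.2 ?_) hWe)
      rw [← sq_abs, hv]
      nlinarith
    have hφ0 := gaussianPDFReal_nonneg 0 1 v
    have hexp : Real.exp (logDensityRatio x m y s e v - logDensityRatio x m y s e 0) ≤ 3 :=
      (Real.exp_le_exp.2 (le_of_abs_le (hH1 v hv.le))).trans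
        (by linarith [Real.exp_one_lt_d9])
    calc κ * gaussianPDFReal 0 1 v *
          Real.exp (logDensityRatio x m y s e v - logDensityRatio x m y s e 0) /
            (e * quantileDevDeriv y s e v)
        ≤ κ * e ^ 4 * 3 / (e * (η / 2)) := by gcongr
      _ = κ * (6 / η * e ^ 3) := by field_simp; ring
  have hn1 : (1 : ℝ) ≤ n - 1 := by
    have : (2 : ℝ) ≤ n := by exact_mod_cast hn
    linarith
  have hW0 : 0 ≤ W := by linarith
  have hz := quantileDev_zero_bounds (s := s) (hη.le.trans hy0) (hy1.trans (by linarith)) he.le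
  have hηW : 6 ≤ η * W := by rwa [div_le_iff₀ hη, mul_comm] at hWη
  -- The slope is at least `η / 2` over a length `W ≥ 6 / η`, so the deviation moves by at least `3`
  -- from its value in `[0, e]` at `0`. The margin `2e` places `T(W)` beyond the mode `n y / (n -
  -- 1)`, since `n e (2e) = 2`.
  have htopDev : 2 * e ≤ quantileDev y s e W := by
    have := mul_sub_le_quantileDev_sub (y := y) (s := s) (e := e) hW0
      fun v hv => (hgood v (abs_le.2 ⟨by linarith [hv.1], hv.2⟩)).2.2
    linarith
  have hbotDev : quantileDev y s e (-W) ≤ 0 := by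
    have := mul_sub_le_quantileDev_sub (y := y) (s := s) (e := e) (neg_nonpos.2 hW0)
      fun v hv => (hgood v (abs_le.2 ⟨hv.1, by linarith [hv.2]⟩)).2.2
    linarith
  have hpos : 0 ≤ F W ∧ F W ≤ κ * (6 / η * e ^ 3) := by
    obtain ⟨g1, g2, g3⟩ := hgood W (abs_of_nonneg hW0).le
    refine ⟨Finset.sum_nonneg fun j _ => ?_, (binomialLowerTail_le_density hxn (by linarith)
      (by linarith) ?_).trans (hdens W (abs_of_nonneg hW0))⟩
    · have h1 : 0 ≤ 1 - betaQuantileApprox y s e W := by linarith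
      have h2 : 0 ≤ betaQuantileApprox y s e W := by linarith
      positivity
    · have h1 : (n : ℝ) * e * (2 * e) ≤ n * e * quantileDev y s e W := by gcongr
      have h2 : e * quantileDev y s e W ≤ 1 - η / 2 - y := by
        unfold betaQuantileApprox at g2; linarith
      have h3 : (n : ℝ) * e * (2 * e) = 2 := by linear_combination 2 * hN
      rw [hX, betaQuantileApprox]
      linarith
  have hneg : 1 - F (-W) ≤ κ * (6 / η * e ^ 3) := by
    have habs : |-W| = W := by rw [abs_neg, abs_of_nonneg hW0]
    obtain ⟨g1, g2, g3⟩ := hgood (-W) habs.le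
    refine (one_sub_binomialLowerTail_le_density hxn (by linarith) (by linarith) ?_).trans
      (hdens (-W) habs)
    have h1 : ((n : ℝ) - 1) * (e * quantileDev y s e (-W)) ≤ 0 :=
      mul_nonpos_of_nonneg_of_nonpos (by linarith) (mul_nonpos_of_nonneg_of_nonpos he.le hbotDev)
    rw [hX, betaQuantileApprox]
    linarith
  have hFneg : F (-W) ≤ 1 := by
    obtain ⟨g1, g2, g3⟩ := hgood (-W) (by rw [abs_neg, abs_of_nonneg hW0])
    rw [← binomialLowerTail_zero n x]
    exact (strictAntiOn_binomialLowerTail hxn).antitoneOn ⟨le_rfl, zero_le_one⟩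
      ⟨by linarith, by linarith⟩ (by linarith)
  have htail : Real.exp 8 * Real.exp (-(4 * W)) ≤ Real.exp 8 * e ^ 3 := by
    gcongr
    have h1 : Real.exp (-(4 * W)) ≤ Real.exp (-(2 * W)) := Real.exp_le_exp.2 (by linarith)
    have h2 : e ^ 4 ≤ e ^ 3 := pow_le_pow_of_le_one he.le he1 (by norm_num)
    linarith
  have hΦ1 : 1 - Φ W ≤ Real.exp 8 * e ^ 3 := (one_sub_cdf_gaussianReal_std_le W).trans htail
  have hΦ2 : Φ (-W) ≤ Real.exp 8 * e ^ 3 := (cdf_gaussianReal_std_neg_le W).trans htail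
  have hw' := abs_le.1 hw
  refine (abs_sub_le_of_normalization hκ0 (hcomp (-W) W le_rfl (by linarith) le_rfl)
    (hcomp w W hw'.1 hw'.2 le_rfl) hpos.1 hpos.2 hneg hFneg hΦ1 (cdf_le_one _ _)
    (cdf_nonneg _ _) hΦ2 (cdf_nonneg _ _) (monotone_cdf _ hw'.2) (by positivity)
    ?_).trans_eq ?_
  · refine le_trans (le_of_eq ?_) hK₂e
    rw [hK₂]; ring
  · rw [hK₂]; ring

/-! ### Uniform expansion of the Clopper–Pearson bound -/

theorem le_sqrt_mul_one_sub {η y : ℝ} (hη : 0 < η) (hy0 : η ≤ y) (hy1 : y ≤ 1 - η) :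
    η ≤ √(y * (1 - y)) :=
  Real.le_sqrt_of_sq_le (by nlinarith)

theorem sqrt_mul_one_sub_le_one (y : ℝ) : √(y * (1 - y)) ≤ 1 :=
  Real.sqrt_le_one.2 (by nlinarith [sq_nonneg (y - 1 / 2)])

theorem exists_abs_binomialLowerTail_sub_le {η : ℝ} (hη : 0 < η) :
    ∃ K : ℝ, 0 ≤ K ∧ ∀ᶠ n : ℕ in Filter.atTop, ∀ (x : ℕ) (y : ℝ), y = x / n → η ≤ y → y ≤ 1 - η →
      ∀ w : ℝ, |w| ≤ Real.log n →
        |binomialLowerTail n x (betaQuantileApprox y (√(y * (1 - y))) (√(n : ℝ))⁻¹ w) -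
          (1 - cdf (gaussianReal 0 1) w)| ≤ K * (√(n : ℝ))⁻¹ ^ 3 ∧
        betaQuantileApprox y (√(y * (1 - y))) (√(n : ℝ))⁻¹ w ∈ Set.Icc 0 1 ∧
        quantileDevDeriv y (√(y * (1 - y))) (√(n : ℝ))⁻¹ w ∈ Set.Icc 0 2 := by
  obtain ⟨C, k, hC1, hb⟩ := exists_quantile_bounds hη
  have hC : 0 ≤ C := zero_le_one.trans hC1
  set K₁ : ℝ := 16 * C / η ^ 3 * ((k + 1 + 2).factorial * Real.exp 2) * Real.pi with hK₁
  set K₂ : ℝ := K₁ + 12 / η + 2 * Real.exp 8 with hK₂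
  have hK₁0 : 0 ≤ K₁ := by positivity
  have hK₂0 : 0 ≤ K₂ := by positivity
  refine ⟨2 * K₁ + 12 / η + 2 * K₂ + Real.exp 8, by positivity, ?_⟩
  have hlog : Filter.Tendsto (fun n : ℕ => Real.log n) Filter.atTop Filter.atTop :=
    Real.tendsto_log_atTop.comp tendsto_natCast_atTop_atTop
  -- The cut-off is `W = log n`, for which `exp (-2W) = n⁻² = e⁴`. In the minimum, `η / 4` keeps the
  -- quantile inside `(0, 1)` and its slope positive, while `1` gives slope at most `s + 1 ≤ 2`.
  filter_upwards [Filter.eventually_ge_atTop 2,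
    hlog.eventually_ge_atTop 4, hlog.eventually_ge_atTop (6 / η),
    (tendsto_log_pow_mul_inv_sqrt C k).eventually_le_const (show 0 < min (η / 4) 1 by positivity),
    (tendsto_log_pow_mul_inv_sqrt (8 * C / η ^ 3) (k + 1)).eventually_le_const zero_lt_one,
    (tendsto_log_pow_mul_inv_sqrt K₂ 0).eventually_le_const (show (0 : ℝ) < 1 / 2 by norm_num)]
    with n hn hW4 hWη hW hW1 hK₂e x y hy hy0 hy1 w hw
  have hn0 : (0 : ℝ) < n := by positivity
  have hn1 : (1 : ℝ) ≤ n := by exact_mod_cast (by omega : 1 ≤ n)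
  set e := (√(n : ℝ))⁻¹ with he
  have he0 : 0 < e := inv_pos.2 (Real.sqrt_pos.2 hn0)
  have he1 : e ≤ 1 := inv_le_one_of_one_le₀ (Real.one_le_sqrt.2 hn1)
  have he2 : (n : ℝ) * e ^ 2 = 1 := by
    rw [he, inv_pow, Real.sq_sqrt hn0.le, mul_inv_cancel₀ hn0.ne']
  have he3 : e ^ 3 ≤ e := by
    simpa using pow_le_pow_of_le_one he0.le he1 (show 1 ≤ 3 by norm_num)
  have hX : (x : ℝ) = n * y := by rw [hy]; field_simp
  have hxn : x < n := by
    have : (x : ℝ) < n := by rw [hX]; nlinarith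
    exact_mod_cast this
  have hsη := le_sqrt_mul_one_sub hη hy0 hy1
  have hs1 := sqrt_mul_one_sub_le_one y
  have hs : √(y * (1 - y)) ^ 2 = y * (1 - y) :=
    Real.sq_sqrt (mul_nonneg (by linarith) (by linarith))
  generalize √(y * (1 - y)) = s at *
  have hb' := fun w => hb y s e w (by linarith) (by linarith) hsη hs1 he0.le he1
  have hW' := hW.trans (min_le_left _ _)
  have hm : C * (1 + |w|) ^ k ≤ C * (1 + Real.log n) ^ k := by gcongr
  have hAs := (hb' w).2.1.trans (mul_le_mul_of_nonneg_left hm he0.le)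
  obtain ⟨g1, g2, g3⟩ := quantile_bounds_of_small hη hy0 hy1 hsη he0.le hW' ((hb' w).1.trans hm) hAs
  refine ⟨abs_binomialLowerTail_sub_le hη hy0 hy1 hs hsη he0 he1 hn hxn he2 hX hC
    hb' hW' ?_ hW4 hWη ?_ hK₁ hK₂ ?_ hw, ⟨by linarith, by linarith⟩, by linarith, ?_⟩
  · refine le_trans ?_ hW1
    rw [mul_right_comm, mul_comm]
    gcongr
  · rw [show -(2 * Real.log n) = Real.log n * (-2 : ℝ) by ring, Real.exp_mul, Real.exp_log hn0]
    refine le_of_eq ?_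
    rw [show (-2 : ℝ) = ((-2 : ℤ) : ℝ) by norm_num, Real.rpow_intCast, zpow_neg]
    rw [eq_comm, show (e ^ 4) = (e ^ 2) ^ 2 by ring, (eq_inv_of_mul_eq_one_right he2), inv_pow]
    norm_cast
  · rw [pow_zero, mul_one, mul_comm] at hK₂e
    refine le_trans ?_ hK₂e
    gcongr
  · have := (abs_le.1 (hAs.trans (hW.trans (min_le_right _ _)))).2
    linarith

theorem gaussianPDFReal_std_ge {z v : ℝ} (h : |v| ≤ |z| + 1) :
    gaussianPDFReal 0 1 (|z| + 1) ≤ gaussianPDFReal 0 1 v := by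
  rw [gaussianPDFReal_std, gaussianPDFReal_std, ← sq_abs v]
  gcongr

theorem mul_le_cdf_gaussianReal_std_sub {z a b : ℝ} (hab : a ≤ b) (ha : -(|z| + 1) ≤ a)
    (hb : b ≤ |z| + 1) :
    gaussianPDFReal 0 1 (|z| + 1) * (b - a) ≤
      cdf (gaussianReal 0 1) b - cdf (gaussianReal 0 1) a :=
  (convex_Icc a b).mul_sub_le_image_sub_of_le_deriv
    (fun v _ => (hasDerivAt_cdf_gaussianReal_std v).continuousAt.continuousWithinAt)
    (fun v _ => (hasDerivAt_cdf_gaussianReal_std v).differentiableAt.differentiableWithinAt)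
    (fun v hv => by
      rw [(hasDerivAt_cdf_gaussianReal_std v).deriv]
      have := interior_subset hv
      exact gaussianPDFReal_std_ge (abs_le.2 ⟨ha.trans this.1, this.2.trans hb⟩))
    a (Set.left_mem_Icc.2 hab) b (Set.right_mem_Icc.2 hab) hab

theorem betaQuantileApprox_sub_le {y s e a b c : ℝ} (he : 0 ≤ e) (hab : a ≤ b)
    (h : ∀ v ∈ Set.Icc a b, quantileDevDeriv y s e v ≤ c) :
    betaQuantileApprox y s e b - betaQuantileApprox y s e a ≤ e * c * (b - a) :=
  (convex_Icc a b).image_sub_le_mul_sub_of_deriv_le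
    (fun v _ => (hasDerivAt_betaQuantileApprox y s e v).continuousAt.continuousWithinAt)
    (fun v _ => (hasDerivAt_betaQuantileApprox y s e v).differentiableAt.differentiableWithinAt)
    (fun v hv => by
      rw [(hasDerivAt_betaQuantileApprox y s e v).deriv]
      exact mul_le_mul_of_nonneg_left (h v (interior_subset hv)) he)
    a (Set.left_mem_Icc.2 hab) b (Set.right_mem_Icc.2 hab) hab

/-- The Clopper–Pearson upper bound agrees with the approximate beta quantile at the normal
quantile up to `O(n⁻²)`, uniformly for `x / n` in a compact subinterval of `(0, 1)`. -/
theorem exists_abs_clopperPearsonUpper_sub_le {α η : ℝ} (hα0 : 0 < α) (hα1 : α < 1) (hη : 0 < η) :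
    ∃ K : ℝ, 0 ≤ K ∧ ∀ᶠ n : ℕ in Filter.atTop, ∀ (x : ℕ) (y : ℝ), y = x / n → η ≤ y → y ≤ 1 - η →
      |clopperPearsonUpper α n x - betaQuantileApprox y (√(y * (1 - y))) (√(n : ℝ))⁻¹
        (normalUpperQuantile α)| ≤ K * (√(n : ℝ))⁻¹ ^ 4 := by
  obtain ⟨K, hK, hev⟩ := exists_abs_binomialLowerTail_sub_le hη
  set z := normalUpperQuantile α with hz
  have hΦz : cdf (gaussianReal 0 1) z = 1 - α := cdf_normalUpperQuantile hα0 hα1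
  set c := gaussianPDFReal 0 1 (|z| + 1) with hc
  have hc0 : 0 < c := gaussianPDFReal_pos 0 1 _ one_ne_zero
  -- `c` bounds the slope of `Φ` below on `[-(|z| + 1), |z| + 1]`. A shift of `z` by `δ = M e³` thus
  -- changes `Φ` by at least `(K + 1) e³`, which exceeds the tail error `K e³`. So `T(z - δ)` and
  -- `T(z + δ)` enclose the bound.
  set M := (K + 1) / c with hM
  have hM0 : 0 ≤ M := by positivity
  have hcM : c * M = K + 1 := by rw [hM]; field_simp
  refine ⟨2 * M, by positivity, ?_⟩
  have hlog : Filter.Tendsto (fun n : ℕ => Real.log n) Filter.atTop Filter.atTop :=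
    Real.tendsto_log_atTop.comp tendsto_natCast_atTop_atTop
  have hsmall : ∀ᶠ n : ℕ in Filter.atTop, (√(n : ℝ))⁻¹ * (M * (1 + Real.log n) ^ 0) ≤ 1 :=
    (tendsto_log_pow_mul_inv_sqrt M 0).eventually_le_const zero_lt_one
  filter_upwards [hev, hlog.eventually_ge_atTop (|z| + 1), hsmall, Filter.eventually_ge_atTop 1]
    with n hG hnz hδ hn x y hy hy0 hy1
  have hn1 : (1 : ℝ) ≤ n := by exact_mod_cast hn
  have hn0 : (0 : ℝ) < n := by linarith
  specialize hG x y hy hy0 hy1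
  generalize √(y * (1 - y)) = s at *
  set e := (√(n : ℝ))⁻¹ with he
  have he0 : 0 < e := inv_pos.2 (Real.sqrt_pos.2 hn0)
  have he1 : e ≤ 1 := inv_le_one_of_one_le₀ (Real.one_le_sqrt.2 hn1)
  have he3 : e ^ 3 ≤ e := by
    simpa using pow_le_pow_of_le_one he0.le he1 (show 1 ≤ 3 by norm_num)
  have hX : (x : ℝ) = n * y := by rw [hy]; field_simp
  have hxn : x < n := by
    have : (x : ℝ) < n := by rw [hX]; nlinarith
    exact_mod_cast this
  set δ := M * e ^ 3 with hδd
  have hδ0 : 0 ≤ δ := by positivity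
  have hδ1 : δ ≤ 1 := by
    rw [pow_zero, mul_one] at hδ
    calc δ ≤ M * e := by rw [hδd]; gcongr
      _ ≤ 1 := by rwa [mul_comm]
  have hzabs := abs_le.1 (le_refl |z|)
  have hin : ∀ w, z - δ ≤ w → w ≤ z + δ → |w| ≤ Real.log n := fun w h1 h2 =>
    (abs_le.2 ⟨by linarith, by linarith⟩ : |w| ≤ |z| + 1).trans hnz
  obtain ⟨hU, hUG⟩ := clopperPearsonUpper_spec hα0 hα1 hxn
  have hanti := strictAntiOn_binomialLowerTail hxn
  have hcδ : c * δ = (K + 1) * e ^ 3 := by rw [hδd, ← mul_assoc, hcM]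
  have he3' : 0 < e ^ 3 := by positivity
  have hup : clopperPearsonUpper α n x ≤ betaQuantileApprox y s e (z + δ) := by
    obtain ⟨h1, h2, -⟩ := hG (z + δ) (hin _ (by linarith) le_rfl)
    have h3 := mul_le_cdf_gaussianReal_std_sub (z := z) (show z ≤ z + δ by linarith)
      (by linarith) (by linarith)
    rw [← hanti.le_iff_ge h2 hU, hUG]
    have := (abs_le.1 h1).2
    rw [add_sub_cancel_left, ← hc, hcδ] at h3
    linarith
  have hlow : betaQuantileApprox y s e (z - δ) ≤ clopperPearsonUpper α n x := by
    obtain ⟨h1, h2, -⟩ := hG (z - δ) (hin _ le_rfl (by linarith))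
    have h3 := mul_le_cdf_gaussianReal_std_sub (z := z) (show z - δ ≤ z by linarith)
      (by linarith) (by linarith)
    rw [← hanti.le_iff_ge hU h2, hUG]
    have := (abs_le.1 h1).1
    rw [sub_sub_cancel, ← hc, hcδ] at h3
    linarith
  have hd1 := betaQuantileApprox_sub_le (y := y) (s := s) he0.le (show z ≤ z + δ by linarith)
    fun v hv => (hG v (hin v (by linarith [hv.1]) hv.2)).2.2.2
  have hd2 := betaQuantileApprox_sub_le (y := y) (s := s) he0.le (show z - δ ≤ z by linarith)
    fun v hv => (hG v (hin v hv.1 (by linarith [hv.2]))).2.2.2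
  have hδe : e * 2 * δ = 2 * M * e ^ 4 := by rw [hδd]; ring
  rw [add_sub_cancel_left, hδe] at hd1
  rw [sub_sub_cancel, hδe] at hd2
  rw [abs_le]
  constructor <;> linarith

/-! ### Central moments of the binomial distribution -/

/-- The expectation of `f` under the binomial distribution with parameters `n` and `p`. -/
noncomputable def binomialMean (n : ℕ) (p : ℝ) (f : ℕ → ℝ) : ℝ :=
  ∑ k ∈ Finset.range (n + 1), (n.choose k : ℝ) * p ^ k * (1 - p) ^ (n - k) * f k

theorem binomialMean_add (n : ℕ) (p : ℝ) (f g : ℕ → ℝ) :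
    binomialMean n p (fun k => f k + g k) = binomialMean n p f + binomialMean n p g := by
  simp only [binomialMean, mul_add, Finset.sum_add_distrib]

theorem binomialMean_const_mul (n : ℕ) (p c : ℝ) (f : ℕ → ℝ) :
    binomialMean n p (fun k => c * f k) = c * binomialMean n p f := by
  simp only [binomialMean, Finset.mul_sum]
  exact Finset.sum_congr rfl fun k _ => by ring

theorem binomialMean_const (n : ℕ) (p c : ℝ) : binomialMean n p (fun _ => c) = c := by
  have := add_pow p (1 - p) n
  rw [add_sub_cancel, one_pow] at this
  rw [binomialMean, ← Finset.sum_mul]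
  conv_rhs => rw [← one_mul c, this]
  congr 1
  exact Finset.sum_congr rfl fun k _ => by ring

theorem abs_binomialMean_le {n : ℕ} {p : ℝ} (hp0 : 0 ≤ p) (hp1 : p ≤ 1) {f g : ℕ → ℝ}
    (h : ∀ k ≤ n, |f k| ≤ g k) : |binomialMean n p f| ≤ binomialMean n p g := by
  refine (Finset.abs_sum_le_sum_abs _ _).trans (Finset.sum_le_sum fun k hk => ?_)
  have hw : 0 ≤ (n.choose k : ℝ) * p ^ k * (1 - p) ^ (n - k) := by
    have : 0 ≤ 1 - p := by linarith
    positivity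
  rw [abs_mul, abs_of_nonneg hw]
  exact mul_le_mul_of_nonneg_left (h k (by simpa [Nat.lt_succ_iff] using hk)) hw

/-- Conditioning on one trial; the central moments follow from it by induction on `n`. -/
theorem binomialMean_succ (n : ℕ) (p : ℝ) (f : ℕ → ℝ) :
    binomialMean (n + 1) p f =
      binomialMean n p fun k => p * f (k + 1) + (1 - p) * f k := by
  have h2 : ∑ k ∈ Finset.range (n + 1),
      (n.choose (k + 1) : ℝ) * p ^ (k + 1) * (1 - p) ^ (n - k) * f (k + 1) +
        (1 - p) ^ (n + 1) * f 0 =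
      ∑ k ∈ Finset.range (n + 1),
        (n.choose k : ℝ) * p ^ k * (1 - p) ^ (n - k) * ((1 - p) * f k) := by
    have h := Finset.sum_range_succ'
      (fun k => (n.choose k : ℝ) * p ^ k * (1 - p) ^ (n + 1 - k) * f k) (n + 1)
    rw [Finset.sum_range_succ] at h
    simp only [Nat.choose_succ_self, Nat.cast_zero, zero_mul, add_zero, Nat.choose_zero_right,
      Nat.cast_one, pow_zero, one_mul, Nat.sub_zero, Nat.add_sub_add_right] at h
    rw [← h]
    refine Finset.sum_congr rfl fun k hk => ?_
    rw [Nat.succ_sub (by simpa [Nat.lt_succ_iff] using hk), pow_succ]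
    ring
  rw [binomialMean_add, binomialMean, Finset.sum_range_succ']
  simp only [Nat.choose_zero_right, Nat.cast_one, pow_zero, one_mul, Nat.sub_zero,
    Nat.add_sub_add_right, Nat.choose_succ_succ, Nat.cast_add, add_mul, Finset.sum_add_distrib]
  rw [add_assoc, h2]
  congr 1
  exact Finset.sum_congr rfl fun k _ => by ring

theorem binomialMean_centered (n : ℕ) (p : ℝ) :
    binomialMean n p (fun k => (k : ℝ) - n * p) = 0 := by
  induction n with
  | zero => simp [binomialMean]
  | succ n ih =>
    rw [binomialMean_succ, ← ih]
    congr 1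
    funext k
    push_cast
    ring

theorem binomialMean_centered_sq (n : ℕ) (p : ℝ) :
    binomialMean n p (fun k => ((k : ℝ) - n * p) ^ 2) = n * (p * (1 - p)) := by
  induction n with
  | zero => simp [binomialMean]
  | succ n ih =>
    rw [binomialMean_succ]
    have : (fun k : ℕ => p * (((k + 1 : ℕ) : ℝ) - ((n + 1 : ℕ) : ℝ) * p) ^ 2 +
        (1 - p) * ((k : ℝ) - ((n + 1 : ℕ) : ℝ) * p) ^ 2) =
        fun k : ℕ => ((k : ℝ) - n * p) ^ 2 + p * (1 - p) := by
      funext k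
      push_cast
      ring
    rw [this, binomialMean_add, ih, binomialMean_const]
    push_cast
    ring

theorem binomialMean_centered_pow_four_le (n : ℕ) {p : ℝ} (hp0 : 0 ≤ p) (hp1 : p ≤ 1) :
    binomialMean n p (fun k => ((k : ℝ) - n * p) ^ 4) ≤ n ^ 2 := by
  induction n with
  | zero => simp [binomialMean]
  | succ n ih =>
    rw [binomialMean_succ]
    have : (fun k : ℕ => p * (((k + 1 : ℕ) : ℝ) - ((n + 1 : ℕ) : ℝ) * p) ^ 4 +
        (1 - p) * ((k : ℝ) - ((n + 1 : ℕ) : ℝ) * p) ^ 4) =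
        fun k : ℕ => ((k : ℝ) - n * p) ^ 4 + (6 * (p * (1 - p)) * ((k : ℝ) - n * p) ^ 2 +
          (4 * (p * (1 - p) * (1 - 2 * p)) * ((k : ℝ) - n * p) +
            p * (1 - p) * (1 - 3 * (p * (1 - p))))) := by
      funext k
      push_cast
      ring
    rw [this, binomialMean_add, binomialMean_add, binomialMean_add, binomialMean_const_mul,
      binomialMean_const_mul, binomialMean_centered, binomialMean_centered_sq, binomialMean_const]
    have h0 : 0 ≤ p * (1 - p) := mul_nonneg hp0 (by linarith)
    have h1 : p * (1 - p) ≤ 1 / 4 := by nlinarith [sq_nonneg (p - 1 / 2)]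
    generalize p * (1 - p) = v at *
    have hn : (0 : ℝ) ≤ n := by positivity
    have h2 : n * (v * v) ≤ n * (1 / 4 * (1 / 4)) := by gcongr
    push_cast
    nlinarith

theorem integral_binomial_eq_binomialMean (n : ℕ) {p : ℝ} (hp0 : 0 ≤ p) (hp1 : p ≤ 1) (f : ℕ → ℝ) :
    ∫ x, f x ∂(ProbabilityTheory.binomial n ⟨p, hp0, hp1⟩) = binomialMean n p f := by
  rw [integral_binomial, binomialMean]
  refine Finset.sum_congr ?_ fun k _ => by simp
  ext k
  simp

/-! ### Expansion around the true parameter -/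

/-- If `P` is the Taylor polynomial, `s² - P²` is divisible by `d³` and `s + P ≥ η`, so dividing `(s
- P) (s + P)` gives the bound without derivatives of the square root. Smallness of `d` is needed
only for `P ≥ 0`. -/
theorem abs_sqrt_mul_one_sub_taylor_le {p y s s₀ g₁ g₂ η : ℝ} (hs : s ^ 2 = y * (1 - y))
    (hs₀ : s₀ ^ 2 = p * (1 - p)) (hs₀0 : 0 < s₀) (hg₁ : g₁ = (1 - 2 * p) / (2 * s₀))
    (hg₂ : g₂ = -1 / (8 * s₀ ^ 3)) (hη : 0 < η) (hsη : η ≤ s) (hd : |y - p| ≤ 1)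
    (hsmall : |y - p| * (|g₁| + |g₂|) ≤ s₀) :
    |s - (s₀ + g₁ * (y - p) + g₂ * (y - p) ^ 2)| ≤
      (2 * |g₁ * g₂| + g₂ ^ 2) / η * |y - p| ^ 3 := by
  set d := y - p with hdd
  have hy : y = p + d := by rw [hdd]; ring
  set P := s₀ + g₁ * d + g₂ * d ^ 2 with hP
  have hP0 : 0 ≤ P := by
    have h1 : |g₁ * d + g₂ * d ^ 2| ≤ |d| * (|g₁| + |g₂|) := by
      calc |g₁ * d + g₂ * d ^ 2| ≤ |g₁ * d| + |g₂ * d ^ 2| := abs_add_le _ _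
        _ = |d| * (|g₁| + |g₂| * |d|) := by rw [abs_mul, abs_mul, abs_pow]; ring
        _ ≤ |d| * (|g₁| + |g₂| * 1) := by gcongr
        _ = _ := by ring
    have := (abs_le.1 (h1.trans hsmall)).1
    rw [hP]; linarith
  have e1 : 2 * s₀ * g₁ = 1 - 2 * p := by rw [hg₁]; field_simp
  have e2 : g₁ ^ 2 + 2 * s₀ * g₂ = -1 := by
    rw [hg₁, hg₂]
    field_simp
    linear_combination 32 * hs₀
  have e3 : (s - P) * (s + P) = -(d ^ 3 * (2 * (g₁ * g₂) + g₂ ^ 2 * d)) := by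
    have : s ^ 2 = s₀ ^ 2 + (1 - 2 * p) * d - d ^ 2 := by rw [hs, hs₀, hy]; ring
    rw [hP]
    linear_combination this - d * e1 - d ^ 2 * e2
  have h4 : |s - P| * η ≤ |d| ^ 3 * (2 * |g₁ * g₂| + g₂ ^ 2) := by
    calc |s - P| * η ≤ |s - P| * |s + P| := by
          gcongr
          rw [abs_of_nonneg (by linarith)]
          linarith
      _ = |d| ^ 3 * |2 * (g₁ * g₂) + g₂ ^ 2 * d| := by
          rw [← abs_mul, e3, abs_neg, abs_mul, abs_pow]
      _ ≤ _ := by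
          gcongr
          calc |2 * (g₁ * g₂) + g₂ ^ 2 * d| ≤ |2 * (g₁ * g₂)| + |g₂ ^ 2 * d| := abs_add_le _ _
            _ = 2 * |g₁ * g₂| + g₂ ^ 2 * |d| := by
              rw [abs_mul 2, abs_mul (g₂ ^ 2), abs_of_pos (zero_lt_two' ℝ),
                abs_of_nonneg (sq_nonneg g₂)]
            _ ≤ 2 * |g₁ * g₂| + g₂ ^ 2 * 1 := by gcongr
            _ = _ := by ring
  rw [div_mul_eq_mul_div, le_div_iff₀ hη]
  linarith

theorem abs_quantileCoeffThree_sub_le {p y s s₀ η z : ℝ} (hs : s ^ 2 = y * (1 - y))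
    (hs₀ : s₀ ^ 2 = p * (1 - p)) (hη : 0 < η) (hsη : η ≤ s) (hs₀η : η ≤ s₀) (hy0 : 0 ≤ y)
    (hy1 : y ≤ 1) (hp0 : 0 ≤ p) (hp1 : p ≤ 1) :
    |quantileCoeffThree y s z - quantileCoeffThree p s₀ z| ≤
      |z| * ((13 * z ^ 2 + 35) / η +
        |(1 - 13 * p + 13 * p ^ 2) * z ^ 2 + (11 - 35 * p + 17 * p ^ 2)| / η ^ 3) * |y - p| := by
  set D₀ := (1 - 13 * p + 13 * p ^ 2) * z ^ 2 + (11 - 35 * p + 17 * p ^ 2) with hD₀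
  have hs0 : 0 < s := hη.trans_le hsη
  have hs₀0 : 0 < s₀ := hη.trans_le hs₀η
  have hlip : |s₀ - s| * η ≤ |y - p| := by
    calc |s₀ - s| * η ≤ |s₀ - s| * |s₀ + s| := by
          gcongr
          rw [abs_of_nonneg (by linarith)]
          linarith
      _ = |y - p| * |1 - p - y| := by
          rw [← abs_mul, ← abs_mul, ← abs_neg]
          congr 1
          linear_combination hs - hs₀
      _ ≤ |y - p| * 1 := by
          gcongr
          exact abs_le.2 ⟨by linarith, by linarith⟩
      _ = _ := mul_one _
  have hlip' : |s₀ - s| ≤ |y - p| / η := by rwa [le_div_iff₀ hη]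
  have hE : quantileCoeffThree y s z - quantileCoeffThree p s₀ z =
      z / 36 * (s⁻¹ * ((y - p) * ((-13 + 13 * (y + p)) * z ^ 2 + (-35 + 17 * (y + p)))) +
        D₀ * (s₀ - s) * (s⁻¹ * s₀⁻¹)) := by
    rw [quantileCoeffThree, quantileCoeffThree, hD₀]
    field_simp
    ring
  have hB : |(-13 + 13 * (y + p)) * z ^ 2 + (-35 + 17 * (y + p))| ≤ 13 * z ^ 2 + 35 := by
    have h1 : |-13 + 13 * (y + p)| ≤ 13 := abs_le.2 ⟨by linarith, by linarith⟩
    have h2 : |-35 + 17 * (y + p)| ≤ 35 := abs_le.2 ⟨by linarith, by linarith⟩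
    calc _ ≤ |(-13 + 13 * (y + p)) * z ^ 2| + |-35 + 17 * (y + p)| := abs_add_le _ _
      _ ≤ 13 * z ^ 2 + 35 := by
        rw [abs_mul, abs_of_nonneg (sq_nonneg z)]
        gcongr
  have hsi : s⁻¹ ≤ η⁻¹ := inv_anti₀ hη hsη
  have hs₀i : s₀⁻¹ ≤ η⁻¹ := inv_anti₀ hη hs₀η
  rw [hE, abs_mul, mul_assoc |z|]
  refine mul_le_mul (by rw [abs_div]; norm_num; linarith [abs_nonneg z]) ?_ (abs_nonneg _)
    (abs_nonneg _)
  calc _ ≤ |s⁻¹ * ((y - p) * ((-13 + 13 * (y + p)) * z ^ 2 + (-35 + 17 * (y + p))))| +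
        |D₀ * (s₀ - s) * (s⁻¹ * s₀⁻¹)| := abs_add_le _ _
    _ = s⁻¹ * (|y - p| * |(-13 + 13 * (y + p)) * z ^ 2 + (-35 + 17 * (y + p))|) +
        |D₀| * |s₀ - s| * (s⁻¹ * s₀⁻¹) := by
      rw [abs_mul, abs_mul, abs_mul, abs_mul, abs_of_pos (inv_pos.2 hs0),
        abs_of_pos (by positivity : 0 < s⁻¹ * s₀⁻¹)]
    _ ≤ η⁻¹ * (|y - p| * (13 * z ^ 2 + 35)) + |D₀| * (|y - p| / η) * (η⁻¹ * η⁻¹) := by gcongr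
    _ = _ := by field_simp

/-- The quadratic polynomial in `d = x / n - p` that approximates the Clopper–Pearson bound. -/
noncomputable def clopperPearsonQuadratic (p s₀ e z d : ℝ) : ℝ :=
  d + e * z * (s₀ + (1 - 2 * p) / (2 * s₀) * d + -1 / (8 * s₀ ^ 3) * d ^ 2) +
    e ^ 2 * (quantileCoeffTwo p z - (2 * z ^ 2 + 1) / 3 * d) + e ^ 3 * quantileCoeffThree p s₀ z

/-- `quantileCoeffTwo` is affine in `y`, with slope `-(2z² + 1) / 3`, so it leaves no error. Only
the Taylor remainder of `s` and the variation of the third coefficient remain. -/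
theorem betaQuantileApprox_sub_quadratic (p s₀ e z y s : ℝ) :
    betaQuantileApprox y s e z - p - clopperPearsonQuadratic p s₀ e z (y - p) =
      e * z * (s - (s₀ + (1 - 2 * p) / (2 * s₀) * (y - p) + -1 / (8 * s₀ ^ 3) * (y - p) ^ 2)) +
        e ^ 3 * (quantileCoeffThree y s z - quantileCoeffThree p s₀ z) := by
  simp only [betaQuantileApprox, quantileDev, clopperPearsonQuadratic, quantileCoeffTwo]
  ring

theorem abs_clopperPearsonQuadratic_le {p s₀ e z d : ℝ} (he : 0 ≤ e) (he1 : e ≤ 1) (hd : |d| ≤ 1) :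
    |clopperPearsonQuadratic p s₀ e z d| ≤
      1 + |z| * (|s₀| + |(1 - 2 * p) / (2 * s₀)| + |-1 / (8 * s₀ ^ 3)|) +
        (|quantileCoeffTwo p z| + (2 * z ^ 2 + 1) / 3) + |quantileCoeffThree p s₀ z| := by
  rw [clopperPearsonQuadratic]
  generalize (1 - 2 * p) / (2 * s₀) = g₁
  generalize -1 / (8 * s₀ ^ 3) = g₂
  generalize quantileCoeffTwo p z = c₂
  generalize quantileCoeffThree p s₀ z = c₃
  have h1 : |e * z * (s₀ + g₁ * d + g₂ * d ^ 2)| ≤ |z| * (|s₀| + |g₁| + |g₂|) := by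
    calc _ ≤ |e * z| * (|s₀ + g₁ * d| + |g₂ * d ^ 2|) := by
          rw [abs_mul]; gcongr; exact abs_add_le _ _
      _ ≤ |e * z| * (|s₀| + |g₁ * d| + |g₂ * d ^ 2|) := by gcongr; exact abs_add_le _ _
      _ = e * |z| * (|s₀| + |g₁| * |d| + |g₂| * |d| ^ 2) := by
          rw [abs_mul, abs_mul, abs_mul, abs_pow, abs_of_nonneg he]
      _ ≤ 1 * |z| * (|s₀| + |g₁| * 1 + |g₂| * 1 ^ 2) := by gcongr
      _ = _ := by ring
  have h2 : |e ^ 2 * (c₂ - (2 * z ^ 2 + 1) / 3 * d)| ≤ |c₂| + (2 * z ^ 2 + 1) / 3 := by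
    calc _ ≤ |e ^ 2| * (|c₂| + |(2 * z ^ 2 + 1) / 3 * d|) := by
          rw [abs_mul]; gcongr; exact abs_sub _ _
      _ = e ^ 2 * (|c₂| + (2 * z ^ 2 + 1) / 3 * |d|) := by
          rw [abs_mul, abs_of_nonneg (by positivity : 0 ≤ e ^ 2),
            abs_of_nonneg (by positivity : 0 ≤ (2 * z ^ 2 + 1) / 3)]
      _ ≤ 1 ^ 2 * (|c₂| + (2 * z ^ 2 + 1) / 3 * 1) := by gcongr
      _ = _ := by ring
  have h3 : |e ^ 3 * c₃| ≤ |c₃| := by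
    rw [abs_mul, abs_of_nonneg (by positivity : 0 ≤ e ^ 3)]
    exact mul_le_of_le_one_left (abs_nonneg _) (pow_le_one₀ he he1)
  calc _ ≤ |d| + _ + _ + _ := (abs_add_le _ _).trans (add_le_add_left ((abs_add_le _ _).trans
        (add_le_add_left (abs_add_le _ _) _)) _)
    _ ≤ _ := by gcongr

theorem clopperPearsonUpper_mem_Icc {α : ℝ} (hα0 : 0 < α) (hα1 : α < 1) {n x : ℕ} (hx : x ≤ n) :
    clopperPearsonUpper α n x ∈ Set.Icc (0 : ℝ) 1 := by
  rcases hx.lt_or_eq with h | rfl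
  · exact (clopperPearsonUpper_spec hα0 hα1 h).1
  · simp [clopperPearsonUpper_self hα1]

theorem mul_abs_le_sq_add_sq (e d : ℝ) : e * |d| ≤ e ^ 2 + d ^ 2 := by
  rw [← sq_abs d]
  linarith [two_mul_le_add_sq e |d|, sq_nonneg e, sq_nonneg |d|]

theorem mul_abs_pow_three_le (e d : ℝ) : e * |d| ^ 3 ≤ e ^ 4 + e ^ 2 * d ^ 2 + d ^ 4 := by
  have h : 0 ≤ e ^ 4 := by positivity
  calc e * |d| ^ 3 = e * |d| * d ^ 2 := by rw [← sq_abs d]; ring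
    _ ≤ (e ^ 2 + d ^ 2) * d ^ 2 := by gcongr; exact mul_abs_le_sq_add_sq e d
    _ ≤ _ := by linarith

theorem pow_three_mul_abs_le (e d : ℝ) : e ^ 3 * |d| ≤ e ^ 4 + e ^ 2 * d ^ 2 + d ^ 4 := by
  have h : 0 ≤ d ^ 4 := by positivity
  calc e ^ 3 * |d| = e ^ 2 * (e * |d|) := by ring
    _ ≤ e ^ 2 * (e ^ 2 + d ^ 2) := by gcongr; exact mul_abs_le_sq_add_sq e d
    _ ≤ _ := by linarith

theorem exists_abs_clopperPearsonUpper_sub_quadratic_le {α p : ℝ} (hα0 : 0 < α) (hα1 : α < 1)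
    (hp0 : 0 < p) (hp1 : p < 1) :
    ∃ C : ℝ, 0 ≤ C ∧ ∀ᶠ n : ℕ in Filter.atTop, ∀ x ≤ n, ∀ e d : ℝ, e = (√(n : ℝ))⁻¹ →
      d = x / n - p →
      |clopperPearsonUpper α n x - p -
        clopperPearsonQuadratic p (√(p * (1 - p))) e (normalUpperQuantile α) d| ≤
        C * (e ^ 4 + e ^ 2 * d ^ 2 + d ^ 4) := by
  set z := normalUpperQuantile α with hz
  set s₀ := √(p * (1 - p)) with hs₀d
  have hpq : 0 < p * (1 - p) := mul_pos hp0 (sub_pos.2 hp1)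
  have hs₀ : s₀ ^ 2 = p * (1 - p) := Real.sq_sqrt hpq.le
  have hs₀0 : 0 < s₀ := Real.sqrt_pos.2 hpq
  set g₁ := (1 - 2 * p) / (2 * s₀) with hg₁
  set g₂ := -1 / (8 * s₀ ^ 3) with hg₂
  have hg₂0 : 0 < |g₂| := abs_pos.2 (by rw [hg₂]; exact div_ne_zero (by norm_num) (by positivity))
  set η := min p (1 - p) / 2 with hη
  have hη0 : 0 < η := by have : 0 < 1 - p := sub_pos.2 hp1; positivity
  have hηp : 2 * η ≤ p := by rw [hη]; linarith [min_le_left p (1 - p)]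
  have hηq : 2 * η ≤ 1 - p := by rw [hη]; linarith [min_le_right p (1 - p)]
  -- The first bound keeps `y` in `[η, 1 - η]`, as `2η ≤ p` and `2η ≤ 1 - p`; the second is the
  -- smallness required by the Taylor estimate of `s`.
  set δ := min η (s₀ / (|g₁| + |g₂|)) with hδ
  have hδ0 : 0 < δ := by
    have : 0 < |g₁| + |g₂| := by positivity
    positivity
  obtain ⟨K, hK, hev⟩ := exists_abs_clopperPearsonUpper_sub_le hα0 hα1 hη0
  set L₁ := (2 * |g₁ * g₂| + g₂ ^ 2) / η with hL₁
  set L₂ := |z| * ((13 * z ^ 2 + 35) / η +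
        |(1 - 13 * p + 13 * p ^ 2) * z ^ 2 + (11 - 35 * p + 17 * p ^ 2)| / η ^ 3) with hL₂
  set B := 2 + (1 + |z| * (|s₀| + |g₁| + |g₂|) +
        (|quantileCoeffTwo p z| + (2 * z ^ 2 + 1) / 3) + |quantileCoeffThree p s₀ z|) with hB
  have hL₁0 : 0 ≤ L₁ := by positivity
  have hL₂0 : 0 ≤ L₂ := by positivity
  have hB0 : 0 ≤ B := by positivity
  refine ⟨K + |z| * L₁ + L₂ + B / δ ^ 4, by positivity, ?_⟩
  filter_upwards [hev, Filter.eventually_ge_atTop 1] with n hU hn x hx e d he hd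
  have hn1 : (1 : ℝ) ≤ n := by exact_mod_cast hn
  have hn0 : (0 : ℝ) < n := by linarith
  have he0 : 0 < e := by rw [he]; exact inv_pos.2 (Real.sqrt_pos.2 hn0)
  have he1 : e ≤ 1 := by rw [he]; exact inv_le_one_of_one_le₀ (Real.one_le_sqrt.2 hn1)
  specialize hU x _ rfl
  rw [← he] at hU
  have hy0 : (0 : ℝ) ≤ x / n := by positivity
  have hy1 : (x : ℝ) / n ≤ 1 := by
    rw [div_le_one hn0]; exact_mod_cast hx
  generalize (x : ℝ) / n = y at *
  have hd1 : |d| ≤ 1 := abs_le.2 ⟨by linarith, by linarith⟩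
  have hS : 0 ≤ e ^ 4 + e ^ 2 * d ^ 2 + d ^ 4 := by positivity
  rcases le_or_gt |d| δ with hdδ | hdδ
  · have hdη := abs_le.1 (hdδ.trans (min_le_left _ _))
    have hyη : η ≤ y := by linarith [hdη.1]
    have hyη' : y ≤ 1 - η := by linarith [hdη.2]
    have hs : √(y * (1 - y)) ^ 2 = y * (1 - y) := Real.sq_sqrt (mul_nonneg hy0 (by linarith))
    have hsη := le_sqrt_mul_one_sub hη0 hyη hyη'
    have hs₀η : η ≤ s₀ := le_sqrt_mul_one_sub hη0 (by linarith) (by linarith)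
    specialize hU hyη hyη'
    generalize √(y * (1 - y)) = s at *
    have hsmall : |d| * (|g₁| + |g₂|) ≤ s₀ := by
      have := hdδ.trans (min_le_right _ _)
      rwa [le_div_iff₀ (by positivity)] at this
    have h1 := abs_sqrt_mul_one_sub_taylor_le hs hs₀ hs₀0 hg₁ hg₂ hη0 hsη (by rwa [← hd])
      (by rwa [← hd])
    have h2 := abs_quantileCoeffThree_sub_le (z := z) hs hs₀ hη0 hsη hs₀η hy0 hy1 hp0.le hp1.le
    have h3 := betaQuantileApprox_sub_quadratic p s₀ e z y s
    rw [← hd] at h1 h2 h3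
    have h4 := mul_abs_pow_three_le e d
    have h5 := pow_three_mul_abs_le e d
    have h6 : e ^ 4 ≤ e ^ 4 + e ^ 2 * d ^ 2 + d ^ 4 := by
      have : 0 ≤ e ^ 2 * d ^ 2 + d ^ 4 := by positivity
      linarith
    calc |clopperPearsonUpper α n x - p - clopperPearsonQuadratic p s₀ e z d|
        = |(clopperPearsonUpper α n x - betaQuantileApprox y s e z) +
          (e * z * (s - (s₀ + g₁ * d + g₂ * d ^ 2)) +
          e ^ 3 * (quantileCoeffThree y s z - quantileCoeffThree p s₀ z))| := by
          rw [← h3]; congr 1; ring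
      _ ≤ |clopperPearsonUpper α n x - betaQuantileApprox y s e z| +
          (|e * z * (s - (s₀ + g₁ * d + g₂ * d ^ 2))| +
          |e ^ 3 * (quantileCoeffThree y s z - quantileCoeffThree p s₀ z)|) :=
          (abs_add_le _ _).trans (by gcongr; exact abs_add_le _ _)
      _ ≤ K * e ^ 4 + (e * |z| * (L₁ * |d| ^ 3) + e ^ 3 * (L₂ * |d|)) := by
          rw [abs_mul, abs_mul e z, abs_mul (e ^ 3), abs_of_pos he0,
            abs_of_pos (by positivity : 0 < e ^ 3)]
          gcongr
      _ = K * e ^ 4 + |z| * L₁ * (e * |d| ^ 3) + L₂ * (e ^ 3 * |d|) + 0 := by ring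
      _ ≤ K * (e ^ 4 + e ^ 2 * d ^ 2 + d ^ 4) + |z| * L₁ * (e ^ 4 + e ^ 2 * d ^ 2 + d ^ 4) +
          L₂ * (e ^ 4 + e ^ 2 * d ^ 2 + d ^ 4) + B / δ ^ 4 * (e ^ 4 + e ^ 2 * d ^ 2 + d ^ 4) := by
          gcongr
          positivity
      _ = _ := by ring
  -- Far from `p`, including `x = 0` and `x = n`, the left side is at most the constant `B`, while
  -- `d⁴ ≥ δ⁴`.
  · have hUm := clopperPearsonUpper_mem_Icc hα0 hα1 hx
    have hQ := abs_clopperPearsonQuadratic_le (p := p) (s₀ := s₀) (z := z) he0.le he1 hd1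
    have h1 : |clopperPearsonUpper α n x - p - clopperPearsonQuadratic p s₀ e z d| ≤ B := by
      refine (abs_sub _ _).trans ?_
      rw [hB]
      refine add_le_add ?_ hQ
      exact abs_le.2 ⟨by linarith [hUm.1], by linarith [hUm.2]⟩
    have h2 : δ ^ 4 ≤ e ^ 4 + e ^ 2 * d ^ 2 + d ^ 4 := by
      have h3 : δ ^ 4 ≤ |d| ^ 4 := by gcongr
      rw [show |d| ^ 4 = d ^ 4 by rw [← abs_pow, abs_of_nonneg (by positivity)]] at h3
      have : 0 ≤ e ^ 4 + e ^ 2 * d ^ 2 := by positivity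
      linarith
    calc _ ≤ B := h1
      _ = B / δ ^ 4 * δ ^ 4 := by field_simp
      _ ≤ B / δ ^ 4 * (e ^ 4 + e ^ 2 * d ^ 2 + d ^ 4) := by gcongr
      _ ≤ _ := by
        refine mul_le_mul_of_nonneg_right ?_ hS
        have : 0 ≤ K + |z| * L₁ + L₂ := by positivity
        linarith

/-! ### Expectation of the expansion and of its error -/

/-- Terms linear in `d` average to zero, and `d²` averages to `e² s₀²`. The curvature of the
standard deviation thus contributes `-e³ z / (8 s₀)`. -/
theorem binomialMean_clopperPearsonQuadratic {n : ℕ} (hn : n ≠ 0) {p s₀ e z : ℝ}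
    (hs₀ : s₀ ^ 2 = p * (1 - p)) (hs₀0 : s₀ ≠ 0) (he : n * e ^ 2 = 1) :
    binomialMean n p (fun k => clopperPearsonQuadratic p s₀ e z (k / n - p)) =
      e * z * s₀ + e ^ 2 * quantileCoeffTwo p z +
        e ^ 3 * (quantileCoeffThree p s₀ z - z / (8 * s₀)) := by
  have hn0 : (n : ℝ) ≠ 0 := by exact_mod_cast hn
  have hfun : (fun k : ℕ => clopperPearsonQuadratic p s₀ e z (k / n - p)) = fun k : ℕ =>
      (e * z * s₀ + e ^ 2 * quantileCoeffTwo p z + e ^ 3 * quantileCoeffThree p s₀ z) +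
      ((1 + e * z * ((1 - 2 * p) / (2 * s₀)) - e ^ 2 * ((2 * z ^ 2 + 1) / 3)) / n *
        ((k : ℝ) - n * p) + e * z * (-1 / (8 * s₀ ^ 3)) / n ^ 2 * ((k : ℝ) - n * p) ^ 2) := by
    funext k
    rw [clopperPearsonQuadratic, show (k : ℝ) / n - p = (k - n * p) / n by field_simp]
    ring
  rw [hfun, binomialMean_add, binomialMean_const, binomialMean_add, binomialMean_const_mul,
    binomialMean_const_mul, binomialMean_centered, binomialMean_centered_sq, ← hs₀]
  have hn' : (n : ℝ)⁻¹ = e ^ 2 := inv_eq_of_mul_eq_one_right he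
  have : e * z * (-1 / (8 * s₀ ^ 3)) / (n : ℝ) ^ 2 * (n * s₀ ^ 2) =
      -(e * z / (8 * s₀) * (n : ℝ)⁻¹) := by field_simp
  rw [this, hn']
  ring

theorem binomialMean_error_le {n : ℕ} (hn : n ≠ 0) {p e : ℝ} (hp0 : 0 ≤ p) (hp1 : p ≤ 1)
    (he : n * e ^ 2 = 1) :
    binomialMean n p (fun k => e ^ 4 + e ^ 2 * ((k : ℝ) / n - p) ^ 2 + ((k : ℝ) / n - p) ^ 4) ≤
      3 * e ^ 4 := by
  have hn0 : (n : ℝ) ≠ 0 := by exact_mod_cast hn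
  have hn' : (n : ℝ)⁻¹ = e ^ 2 := inv_eq_of_mul_eq_one_right he
  have hfun : (fun k : ℕ => e ^ 4 + e ^ 2 * ((k : ℝ) / n - p) ^ 2 + ((k : ℝ) / n - p) ^ 4) =
      fun k : ℕ => e ^ 4 + e ^ 6 * ((k : ℝ) - n * p) ^ 2 + e ^ 8 * ((k : ℝ) - n * p) ^ 4 := by
    funext k
    rw [show (k : ℝ) / n - p = (k - n * p) * (n : ℝ)⁻¹ by field_simp, hn']
    ring
  rw [hfun, binomialMean_add, binomialMean_add, binomialMean_const, binomialMean_const_mul,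
    binomialMean_const_mul, binomialMean_centered_sq]
  have h4 := mul_le_mul_of_nonneg_left (binomialMean_centered_pow_four_le n hp0 hp1)
    (by positivity : 0 ≤ e ^ 8)
  have e8 : e ^ 8 * (n : ℝ) ^ 2 = e ^ 4 := by
    linear_combination (e ^ 4 * (n * e ^ 2 + 1)) * he
  have e6 : e ^ 6 * (n * (p * (1 - p))) = e ^ 4 * (p * (1 - p)) := by
    linear_combination (e ^ 4 * (p * (1 - p))) * he
  have h1 : e ^ 4 * (p * (1 - p)) ≤ e ^ 4 * 1 := by
    gcongr
    nlinarith
  rw [e6]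
  linarith

theorem theorem3 (α p : ℝ) (hα0 : 0 < α) (hα1 : α < 1) (hp0 : 0 < p) (hp1 : p < 1)
    (q z : ℝ) (hq : q = 1 - p) (hz : z = normalUpperQuantile α) :
    (fun n : ℕ =>
      (∫ x, (clopperPearsonUpper α n x - p) ∂(ProbabilityTheory.binomial n ⟨p, hp0.le, hp1.le⟩)) -
        ((n : ℝ) ^ (-(1 / 2) : ℝ) * z * √(p * q)
          + (3 * (n : ℝ))⁻¹ * (2 * (1 / 2 - p) * z ^ 2 + 1 + q)
          + (n : ℝ) ^ (-(3 / 2) : ℝ) * z * √(p * q) *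
              (-(53 / 36) + (1 / 2 - p) / q + (z ^ 2 + 13 / 2) / (36 * p * q)
                - 13 * z ^ 2 / 36)))
      =O[Filter.atTop] fun n : ℕ => (n : ℝ) ^ (-2 : ℝ) := by
  obtain ⟨C, hC, hev⟩ := exists_abs_clopperPearsonUpper_sub_quadratic_le hα0 hα1 hp0 hp1
  refine Asymptotics.IsBigO.of_bound (C * 3) ?_
  filter_upwards [hev, Filter.eventually_ge_atTop 1] with n hb hn
  have hn1 : (1 : ℝ) ≤ n := by exact_mod_cast hn
  have hn0 : (0 : ℝ) < n := by linarith
  have hq0 : 0 < 1 - p := sub_pos.2 hp1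
  have hpq : 0 < p * (1 - p) := mul_pos hp0 hq0
  set e := (√(n : ℝ))⁻¹ with he
  have he0 : 0 < e := inv_pos.2 (Real.sqrt_pos.2 hn0)
  have he2 : (n : ℝ) * e ^ 2 = 1 := by
    rw [he, inv_pow, Real.sq_sqrt hn0.le, mul_inv_cancel₀ hn0.ne']
  have hninv : (n : ℝ)⁻¹ = e ^ 2 := inv_eq_of_mul_eq_one_right he2
  have hr1 : (n : ℝ) ^ (-(1 / 2) : ℝ) = e := by
    rw [Real.rpow_neg hn0.le, ← Real.sqrt_eq_rpow]
  have hr3 : (n : ℝ) ^ (-(3 / 2) : ℝ) = e ^ 3 := by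
    rw [show (-(3 / 2) : ℝ) = -(1 / 2) * (3 : ℕ) by norm_num, Real.rpow_mul_natCast hn0.le, hr1]
  have hr4 : (n : ℝ) ^ (-2 : ℝ) = e ^ 4 := by
    rw [show (-2 : ℝ) = -(1 / 2) * (4 : ℕ) by norm_num, Real.rpow_mul_natCast hn0.le, hr1]
  rw [integral_binomial_eq_binomialMean n hp0.le hp1.le, hr1, hr3, hr4, mul_inv, hninv, hq]
  rw [← hz] at hb
  set s₀ := √(p * (1 - p)) with hs₀d
  have hs₀ : s₀ ^ 2 = p * (1 - p) := Real.sq_sqrt hpq.le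
  have hs₀0 : s₀ ≠ 0 := (Real.sqrt_pos.2 hpq).ne'
  -- The stated expansion is exactly the mean of the quadratic. To compare the `e³` terms, `s₀` is
  -- written as `s₀⁻¹ p (1 - p)`, which clears the denominators `p` and `1 - p`.
  have htarget : e * z * s₀ + 3⁻¹ * e ^ 2 * (2 * (1 / 2 - p) * z ^ 2 + 1 + (1 - p)) +
      e ^ 3 * z * s₀ * (-(53 / 36) + (1 / 2 - p) / (1 - p) + (z ^ 2 + 13 / 2) / (36 * p * (1 - p))
        - 13 * z ^ 2 / 36) =
      binomialMean n p (fun k => clopperPearsonQuadratic p s₀ e z (k / n - p)) := by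
    rw [binomialMean_clopperPearsonQuadratic (by omega) hs₀ hs₀0 he2]
    have h1 : s₀ * (-(53 / 36) + (1 / 2 - p) / (1 - p) + (z ^ 2 + 13 / 2) / (36 * p * (1 - p))
        - 13 * z ^ 2 / 36) = s₀⁻¹ * (p * (1 - p) * (-(53 / 36) + (1 / 2 - p) / (1 - p) +
          (z ^ 2 + 13 / 2) / (36 * p * (1 - p)) - 13 * z ^ 2 / 36)) := by
      rw [← mul_assoc s₀⁻¹, ← hs₀]
      congr 1
      field_simp
    have h2 : p * (1 - p) * (-(53 / 36) + (1 / 2 - p) / (1 - p) +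
          (z ^ 2 + 13 / 2) / (36 * p * (1 - p)) - 13 * z ^ 2 / 36) =
        p * (1 - p) * (-(53 / 36) - 13 * z ^ 2 / 36) + p * (1 / 2 - p) + (z ^ 2 + 13 / 2) / 36 := by
      have := hp0.ne'
      have := hq0.ne'
      field_simp
      ring
    rw [mul_assoc (e ^ 3 * z), h1, h2, quantileCoeffTwo, quantileCoeffThree]
    field_simp
    ring
  rw [htarget, Real.norm_eq_abs, Real.norm_eq_abs, abs_of_pos (by positivity : 0 < e ^ 4)]
  have hsub : binomialMean n p (fun x => clopperPearsonUpper α n x - p) -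
      binomialMean n p (fun k => clopperPearsonQuadratic p s₀ e z (k / n - p)) =
      binomialMean n p (fun k => clopperPearsonUpper α n k - p -
        clopperPearsonQuadratic p s₀ e z (k / n - p)) := by
    simp only [binomialMean, ← Finset.sum_sub_distrib, ← mul_sub]
  rw [hsub]
  refine (abs_binomialMean_le hp0.le hp1.le fun k hk => hb k hk e _ rfl rfl).trans ?_
  rw [binomialMean_const_mul, mul_assoc]
  exact mul_le_mul_of_nonneg_left (binomialMean_error_le (by omega) hp0.le hp1.le he2) hC
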